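/- Let $\mathbb{T}=\mathbb{R}/2\pi\mathbb{Z}$, let $\hat f(k)=\frac1{2\pi}\int_{\mathbb{T}}f(x)e^{-ikx}\,dx$, and for $s\ge 0$ let $\|f\|_{H^s}^2=\sum_{k\in\mathbb{Z}}(1+k^2)^s|\hat f(k)|^2$. All functions are real valued; $e^{t\Delta}$ is the heat semigroup, i.e. the Fourier multiplier $e^{-tk^2}$. Let $T>0$, $p\in[2,\infty)$ and $w_0\in L^p(\mathbb{T})$. Let $\alpha\in[0,\tfrac12)$ with $p\le \frac{2}{1-2\alpha}$, and let $v\in C([0,T];H^\alpha(\mathbb{T}))$ be given. Consider the Burgers remainder equation $$\partial_t w=\partial_{xx}w+\partial_x\big((w+v)^2\big)\ \text{ on }[0,T]\times\mathbb{T},\qquad w|_{t=0}=w_0 .$$ For $T_*\in(0,T]$, a mild solution on $[0,T_*]$ is a function $w\in C([0,T_*];L^p(\mathbb{T}))$ such that for every $t\in[0,T_*]$ $$w_t=e^{t\Delta}w_0+\int_0^t e^{(t-s)\Delta}\partial_x\big((w_s+v_s)^2\big)\,ds ,$$ where the integral is a convergent Bochner integral in $L^p(\mathbb{T})$. Then there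 exists $T_*\in(0,T]$ such that there is exactly one mild solution $w\in C([0,T_*];L^p(\mathbb{T}))$ on $[0,T_*]$. Furthermore, if $p>4$, there exists $\beta>1$ such that $\|w_t\|_{H^\beta}<\infty$ for every $t\in(0,T_*]$. -/

import Mathlib

open MeasureTheory Set Filter Topology
open scoped ENNReal Real

noncomputable section

namespace BurgersRemainder

instance fact_two_pi_pos : Fact (0 < 2 * π) := ⟨Real.two_pi_pos⟩

/-- The one dimensional torus `ℝ / 2πℤ`, so that `fourier k` is `x ↦ exp (i k x)` and
`∂ₓₓ (fourier k) = - k² fourier k`. -/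
abbrev Torus : Type := AddCircle (2 * π)

/-- The real Lebesgue space `L^p` of the torus (Lebesgue measure, of total mass `2π`). -/
abbrev LpT (p : ℝ≥0∞) : Type := Lp ℝ p (volume : Measure Torus)

/-- Fourier coefficients `k ↦ (1 / 2π) ∫ f(x) exp (- i k x) dx` of a real function. -/
def coeff (f : Torus → ℝ) (k : ℤ) : ℂ :=
  fourierCoeff (fun x => (f x : ℂ)) k

/-- The squared Sobolev norm `‖f‖²_{H^s} = ∑ₖ (1 + k²)^s |f̂(k)|²`, with values in `[0, ∞]`. -/
def sobolevNormSq (s : ℝ) (f : Torus → ℝ) : ℝ≥0∞ :=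
  ∑' k : ℤ, ENNReal.ofReal ((1 + (k : ℝ) ^ 2) ^ s) * ‖coeff f k‖ₑ ^ 2

/-- `v ∈ C([0,T]; H^s)`, for `s ≥ 0`: every `v t` lies in `H^s ⊆ L²`, and `t ↦ v t` is continuous
on `[0,T]` for the norm of `H^s`. -/
def IsContinuousSobolevPath (T s : ℝ) (v : ℝ → LpT 2) : Prop :=
  ∀ t ∈ Icc 0 T, sobolevNormSq s (v t) < ∞ ∧
    Tendsto (fun r => sobolevNormSq s (v r - v t : LpT 2)) (𝓝[Icc 0 T] t) (𝓝 0)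

/-- The derivative `∂ₓ` of a periodic distribution, on its sequence of Fourier coefficients. -/
def derivCoeff (a : ℤ → ℂ) (k : ℤ) : ℂ :=
  Complex.I * k * a k

/-- For `t > 0`, the function `e^{tΔ} φ`, where `φ` is the real periodic distribution with Fourier
coefficients `a` (of at most polynomial growth, and with `a (-k)` conjugate to `a k`). The series
`∑ₖ e^{-t k²} a k e^{i k x}` then converges in the space of continuous functions, and its sum is
real valued; the real part only turns it into a function with values in `ℝ`. -/
def heatSmooth (t : ℝ) (a : ℤ → ℂ) : C(Torus, ℝ) :=
  (⟨Complex.re, Complex.continuous_re⟩ : C(ℂ, ℝ)).comp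
    (∑' k : ℤ, ((Real.exp (-t * (k : ℝ) ^ 2) : ℂ) * a k) • (fourier k : C(Torus, ℂ)))

/-- The heat semigroup `e^{tΔ}`, `t ≥ 0`, on `L^p`. -/
def heat (p : ℝ≥0∞) [Fact (1 ≤ p)] (t : ℝ) (f : LpT p) : LpT p :=
  if t ≤ 0 then f else ContinuousMap.toLp p volume ℝ (heatSmooth t (coeff f))

/-- The element `e^{rΔ} ∂ₓ (w + v)²` of `L^p`, for `r > 0`. -/
def duhamelTerm (p : ℝ≥0∞) [Fact (1 ≤ p)] (r : ℝ) (w : LpT p) (v : LpT 2) : LpT p :=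
  ContinuousMap.toLp p volume ℝ
    (heatSmooth r (derivCoeff (coeff (fun x => (w x + v x) ^ 2))))

/-- `w ∈ C([0,T]; L^p)` is a mild solution on `[0,T]` of
`∂ₜ w = ∂ₓₓ w + ∂ₓ (w + v)²`, `w|_{t=0} = w₀`, that is
`w t = e^{tΔ} w₀ + ∫₀ᵗ e^{(t-s)Δ} ∂ₓ (w s + v s)² ds` for all `t ∈ [0,T]`,
with a (convergent) Bochner integral in `L^p`. -/
def IsMildSolution (p : ℝ≥0∞) [Fact (1 ≤ p)] (T : ℝ) (v : ℝ → LpT 2) (w₀ : LpT p)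
    (w : ℝ → LpT p) : Prop :=
  ContinuousOn w (Icc 0 T) ∧
    ∀ t ∈ Icc 0 T,
      IntervalIntegrable (fun s => duhamelTerm p (t - s) (w s) (v s)) volume 0 t ∧
      w t = heat p t w₀ + ∫ s in (0 : ℝ)..t, duhamelTerm p (t - s) (w s) (v s)

end BurgersRemainder

end

open MeasureTheory Set Filter Topology
open scoped ENNReal Real

noncomputable section

namespace BurgersRemainder

/-! The argument is a contraction in `C([0,T'];L^p)`, followed by one bootstrap on Fourier
coefficients.

Well-posedness. Since `p ≥ 2` and `v` is continuous in `L²`, the map `w ↦ (w + v)²` from `L^p` to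
`L¹` is Lipschitz on balls. The operator `e^{rΔ} ∂ₓ` maps `L¹` to `L^p` with norm at most `C
r^{θ-1}` for some `θ > 0` (`exists_norm_heat_deriv_le`): summing Fourier series bounds its values in
`L^∞` and in `L²`, and `‖g‖_p^p ≤ ‖g‖_∞^{p-2} ‖g‖₂²` interpolates. As `r^{θ-1}` is integrable at
`0`, Banach's theorem gives a solution for short time (`exists_isAbstractMild`), and a singular
Grönwall lemma gives uniqueness among all continuous paths (`IsAbstractMild.eqOn`). The free part `t
↦ e^{tΔ} w₀` is continuous in `L^p` (`continuousOn_heat`), because the heat kernel is nonnegative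
with mass one, so that the semigroup contracts `L^p`.

Regularity. If `p > 4`, then `p ≤ 2 / (1 - 2α)` forces `α > 1/4`. Each Fourier mode of `w` solves a
scalar Duhamel equation in which the factor `k²` coming from `∂ₓ` is absorbed by Cauchy–Schwarz
against `e^{-(t-s)k²}` (`norm_sq_coeff_mild_le`). Coefficients of an `L¹` function are bounded, so
`|ŵ_t(k)|² ≲ 1/(1+k²)`, and `w` is bounded in `H^α` away from time `0` because `α < 1/2`. Hence `(w
+ v)²` is bounded there in some `H^σ` with `σ > 0` (`exists_sobolevNormSq_sq_le`), and Duhamel's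
formula gains almost one derivative, which gives `H^{1+σ-δ}` (`sobolevNormSq_mild_lt_top`). -/

section AbstractMild

/-! ### Abstract mild equations with a weakly singular kernel -/

variable {E Y : Type*} [NormedAddCommGroup E] [NormedSpace ℝ E]
  [NormedAddCommGroup Y] [NormedSpace ℝ Y]

lemma intervalIntegrable_sub_rpow {θ : ℝ} (hθ : 0 < θ) (a b t : ℝ) :
    IntervalIntegrable (fun s => (t - s) ^ (θ - 1)) volume a b := by
  have h : IntervalIntegrable (fun s : ℝ => s ^ (θ - 1)) volume (t - a) (t - b) :=
    intervalIntegral.intervalIntegrable_rpow' (by linarith)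
  simpa using h.comp_sub_left t

lemma integral_sub_rpow {θ : ℝ} (hθ : 0 < θ) {t : ℝ} :
    ∫ s in (0 : ℝ)..t, (t - s) ^ (θ - 1) = t ^ θ / θ := by
  rw [intervalIntegral.integral_comp_sub_left (fun x : ℝ => x ^ (θ - 1)) t]
  simp only [sub_self, sub_zero]
  rw [integral_rpow (Or.inl (by linarith))]
  simp [Real.zero_rpow hθ.ne']

lemma continuousOn_convolution_integrand {S : ℝ → Y →L[ℝ] E} (hS : ContinuousOn S (Ioi 0))
    {T t : ℝ} (ht : t ≤ T) {f : ℝ → Y} (hf : ContinuousOn f (Icc 0 T)) :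
    ContinuousOn (fun s => S (t - s) (f s)) (Ioo 0 t) := by
  refine ContinuousOn.clm_apply (hS.comp (by fun_prop) ?_)
    (hf.mono fun s hs => ⟨hs.1.le, hs.2.le.trans ht⟩)
  intro s hs
  exact sub_pos.2 hs.2

lemma intervalIntegrable_convolution {S : ℝ → Y →L[ℝ] E} (hS : ContinuousOn S (Ioi 0))
    {T θ C : ℝ} (hθ : 0 < θ) (hSb : ∀ r ∈ Ioc 0 T, ‖S r‖ ≤ C * r ^ (θ - 1))
    {f : ℝ → Y} (hf : ContinuousOn f (Icc 0 T)) {t : ℝ} (ht : t ∈ Icc 0 T) :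
    IntervalIntegrable (fun s => S (t - s) (f s)) volume 0 t := by
  obtain ⟨M, hM⟩ := isCompact_Icc.exists_bound_of_continuousOn hf
  have hb := (intervalIntegrable_sub_rpow hθ 0 t t).const_mul (C * M)
  rw [intervalIntegrable_iff_integrableOn_Ioo_of_le ht.1] at hb ⊢
  refine Integrable.mono' hb
    ((continuousOn_convolution_integrand hS ht.2 hf).aestronglyMeasurable measurableSet_Ioo) ?_
  filter_upwards [ae_restrict_mem measurableSet_Ioo] with s hs
  have h1 := hSb (t - s) ⟨sub_pos.2 hs.2, by linarith [hs.1, ht.2]⟩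
  have h2 := hM s ⟨hs.1.le, hs.2.le.trans ht.2⟩
  calc ‖S (t - s) (f s)‖ ≤ ‖S (t - s)‖ * ‖f s‖ := (S (t - s)).le_opNorm _
    _ ≤ (C * (t - s) ^ (θ - 1)) * M := by
      gcongr
      exact (norm_nonneg _).trans h1
    _ = _ := by ring

lemma norm_convolution_le {S : ℝ → Y →L[ℝ] E} {T θ C : ℝ} (hθ : 0 < θ)
    (hSb : ∀ r ∈ Ioc 0 T, ‖S r‖ ≤ C * r ^ (θ - 1))
    {f : ℝ → Y} {φ : ℝ → ℝ} (hφ : ContinuousOn φ (Icc 0 T)) (hfφ : ∀ s ∈ Icc 0 T, ‖f s‖ ≤ φ s)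
    {t : ℝ} (ht : t ∈ Icc 0 T) :
    ‖∫ s in (0 : ℝ)..t, S (t - s) (f s)‖ ≤ C * ∫ s in (0 : ℝ)..t, (t - s) ^ (θ - 1) * φ s := by
  rw [← intervalIntegral.integral_const_mul]
  refine intervalIntegral.norm_integral_le_of_norm_le ht.1 ?_ ?_
  · have hne : ∀ᵐ s : ℝ, s ≠ t := by simp [ae_iff, measure_singleton]
    filter_upwards [hne] with s hst hs
    have hlt : s < t := lt_of_le_of_ne hs.2 hst
    have h1 := hSb (t - s) ⟨sub_pos.2 hlt, by linarith [hs.1, ht.2]⟩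
    have h2 := hfφ s ⟨hs.1.le, hs.2.trans ht.2⟩
    calc ‖S (t - s) (f s)‖ ≤ ‖S (t - s)‖ * ‖f s‖ := (S (t - s)).le_opNorm _
      _ ≤ (C * (t - s) ^ (θ - 1)) * φ s := by
        gcongr
        exact (norm_nonneg _).trans h1
      _ = _ := by ring
  · refine ((intervalIntegrable_sub_rpow hθ 0 t t).mul_continuousOn ?_).const_mul C
    rw [uIcc_of_le ht.1]
    exact hφ.mono (Icc_subset_Icc_right ht.2)

lemma norm_convolution_le_const {S : ℝ → Y →L[ℝ] E} {T θ C M : ℝ} (hθ : 0 < θ)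
    (hSb : ∀ r ∈ Ioc 0 T, ‖S r‖ ≤ C * r ^ (θ - 1))
    {f : ℝ → Y} (hf : ∀ s ∈ Icc 0 T, ‖f s‖ ≤ M) {t : ℝ} (ht : t ∈ Icc 0 T) :
    ‖∫ s in (0 : ℝ)..t, S (t - s) (f s)‖ ≤ C * M * (t ^ θ / θ) := by
  refine (norm_convolution_le hθ hSb (φ := fun _ => M) continuousOn_const hf ht).trans_eq ?_
  rw [intervalIntegral.integral_mul_const, integral_sub_rpow hθ]
  ring

/-- The substitution `r = t - s` moves `t` off the singular factor, and an indicator fixes the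
interval of integration. Dominated convergence then applies with the bound `C M r^{θ-1}`; the
integrand is continuous in `t` at `t₀` except when `r = t₀`, a null set. -/
lemma continuousOn_convolution {S : ℝ → Y →L[ℝ] E} (hS : ContinuousOn S (Ioi 0))
    {T θ C : ℝ} (hT : 0 ≤ T) (hθ : 0 < θ) (hSb : ∀ r ∈ Ioc 0 T, ‖S r‖ ≤ C * r ^ (θ - 1))
    {f : ℝ → Y} (hf : ContinuousOn f (Icc 0 T)) :
    ContinuousOn (fun t => ∫ s in (0 : ℝ)..t, S (t - s) (f s)) (Icc 0 T) := by
  -- Extending `f` by its endpoint values gives a meaning to `f (t - r)` for all `t` and `r`.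
  set g : ℝ → Y := IccExtend hT (fun x => f x) with hg
  have hgc : Continuous g := (continuousOn_iff_continuous_domRestrict.1 hf).Icc_extend'
  have hgf : ∀ s ∈ Icc 0 T, g s = f s := fun s hs => IccExtend_of_mem hT _ hs
  obtain ⟨M, hM⟩ := isCompact_Icc.exists_bound_of_continuousOn hf
  have hgM : ∀ s, ‖g s‖ ≤ M := fun s => hM _ (projIcc 0 T hT s).2
  set F : ℝ → ℝ → E := fun t => (Iio t).indicator fun r => S r (g (t - r)) with hF
  have key : ∀ t ∈ Icc 0 T, ∫ s in (0 : ℝ)..t, S (t - s) (f s) = ∫ r in (0 : ℝ)..T, F t r := by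
    intro t ht
    have h1 : ∫ s in (0 : ℝ)..t, S (t - s) (f s) = ∫ s in (0 : ℝ)..t, S (t - s) (g (t - (t - s))) := by
      refine intervalIntegral.integral_congr fun s hs => ?_
      rw [uIcc_of_le ht.1] at hs
      simp only [sub_sub_cancel]
      rw [hgf s ⟨hs.1, hs.2.trans ht.2⟩]
    rw [h1, intervalIntegral.integral_comp_sub_left (fun r => S r (g (t - r))) t]
    simp only [sub_self, sub_zero]
    rw [intervalIntegral.integral_of_le ht.1, intervalIntegral.integral_of_le hT,
      integral_Ioc_eq_integral_Ioo, hF]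
    simp only
    rw [setIntegral_indicator measurableSet_Iio]
    congr 2
    ext r
    simp only [mem_Ioo, mem_inter_iff, mem_Ioc, mem_Iio]
    constructor
    · rintro ⟨h1, h2⟩; exact ⟨⟨h1, h2.le.trans ht.2⟩, h2⟩
    · rintro ⟨⟨h1, _⟩, h2⟩; exact ⟨h1, h2⟩
  refine ContinuousOn.congr ?_ key
  refine continuousOn_of_forall_continuousAt fun t₀ ht₀ => ?_
  have hcS : ∀ t, ContinuousOn (fun r => S r (g (t - r))) (Ioc 0 T) := fun t =>
    (hS.mono fun r hr => hr.1).clm_apply (by fun_prop)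
  refine intervalIntegral.continuousAt_of_dominated_interval
    (bound := fun r => C * M * r ^ (θ - 1)) ?_ ?_ ?_ ?_
  · refine Eventually.of_forall fun t => ?_
    rw [uIoc_of_le hT]
    exact ((hcS t).aestronglyMeasurable measurableSet_Ioc).indicator measurableSet_Iio
  · refine Eventually.of_forall fun t => Eventually.of_forall fun r hr => ?_
    rw [uIoc_of_le hT] at hr
    refine (norm_indicator_le_norm_self _ _).trans ?_
    calc ‖S r (g (t - r))‖ ≤ ‖S r‖ * ‖g (t - r)‖ := (S r).le_opNorm _
      _ ≤ (C * r ^ (θ - 1)) * M := by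
        gcongr
        · exact (norm_nonneg _).trans (hSb r hr)
        · exact hSb r hr
        · exact hgM _
      _ = _ := by ring
  · exact (intervalIntegral.intervalIntegrable_rpow' (by linarith)).const_mul _
  · have hne : ∀ᵐ r : ℝ, r ≠ t₀ := by simp [ae_iff, measure_singleton]
    filter_upwards [hne] with r hr _
    rcases lt_or_gt_of_ne hr with h | h
    · have hev : (fun t => S r (g (t - r))) =ᶠ[𝓝 t₀] fun t => F t r := by
        filter_upwards [Ioi_mem_nhds h] with t ht
        exact (indicator_of_mem (show r ∈ Iio t from ht) (fun r => S r (g (t - r)))).symm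
      refine ContinuousAt.congr ?_ hev
      exact ((S r).continuous.comp (hgc.comp (by fun_prop))).continuousAt
    · have hev : (fun _ => (0 : E)) =ᶠ[𝓝 t₀] fun t => F t r := by
        filter_upwards [Iio_mem_nhds h] with t ht
        exact (indicator_of_notMem (show r ∉ Iio t from fun h' => lt_asymm (mem_Iio.1 h') (mem_Iio.1 ht))
          (fun r => S r (g (t - r)))).symm
      exact continuousAt_const.congr hev

/-- The integral over the whole half line is `Γ(θ) lam^{-θ}`, which tends to `0` as `lam` grows. -/
lemma exists_integral_rpow_mul_exp_le {θ : ℝ} (hθ : 0 < θ) {ε : ℝ} (hε : 0 < ε) :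
    ∃ lam : ℝ, 0 < lam ∧ ∀ t, 0 ≤ t →
      ∫ s in (0 : ℝ)..t, (t - s) ^ (θ - 1) * Real.exp (-lam * (t - s)) ≤ ε := by
  have hG := Real.Gamma_pos_of_pos hθ
  have hlim : Tendsto (fun lam : ℝ => (1 / lam) ^ θ * Real.Gamma θ) atTop (𝓝 0) := by
    have h1 : Tendsto (fun lam : ℝ => (1 / lam) ^ θ) atTop (𝓝 0) := by
      have := tendsto_rpow_neg_atTop hθ
      refine this.congr' ?_
      filter_upwards [eventually_gt_atTop 0] with x hx
      rw [one_div, Real.inv_rpow hx.le, Real.rpow_neg hx.le]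
    simpa using h1.mul_const (Real.Gamma θ)
  obtain ⟨lam, hlam, hpos⟩ := ((hlim.eventually (gt_mem_nhds hε)).and (eventually_gt_atTop 0)).exists
  refine ⟨lam, hpos, fun t ht => ?_⟩
  have hint := Real.integral_rpow_mul_exp_neg_mul_Ioi hθ hpos
  -- A non-integrable function has Bochner integral `0`, whereas this integral is positive.
  have hi : IntegrableOn (fun x : ℝ => x ^ (θ - 1) * Real.exp (-(lam * x))) (Ioi 0) := by
    by_contra h
    rw [integral_undef h] at hint
    have : 0 < (1 / lam) ^ θ * Real.Gamma θ := by positivity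
    linarith
  rw [intervalIntegral.integral_comp_sub_left
    (fun r => r ^ (θ - 1) * Real.exp (-lam * r)) t]
  simp only [sub_self, sub_zero]
  rw [intervalIntegral.integral_of_le ht]
  refine le_trans ?_ hlam.le
  rw [← hint]
  simp only [neg_mul]
  refine setIntegral_mono_set hi ?_ (Ioc_subset_Ioi_self.eventuallyLE)
  filter_upwards [ae_restrict_mem measurableSet_Ioi] with x hx
  have : (0 : ℝ) < x := hx
  show (0 : ℝ) ≤ x ^ (θ - 1) * Real.exp (-(lam * x))
  positivity

/-- Grönwall's lemma with a weakly singular kernel, in the homogeneous case. -/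
lemma eq_zero_of_le_singular_integral {T θ K : ℝ} (hT : 0 ≤ T) (hθ : 0 < θ) (hK : 0 ≤ K)
    {φ : ℝ → ℝ} (hφ : ContinuousOn φ (Icc 0 T)) (hφ0 : ∀ t ∈ Icc 0 T, 0 ≤ φ t)
    (h : ∀ t ∈ Icc 0 T, φ t ≤ K * ∫ s in (0 : ℝ)..t, (t - s) ^ (θ - 1) * φ s) :
    ∀ t ∈ Icc 0 T, φ t = 0 := by
  -- With this constant the singular integral operator shrinks the weighted norm `sup e^{-lam t} φ
  -- t` by a factor `1/2`, so the maximum `A` satisfies `A ≤ A / 2`.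
  obtain ⟨lam, hlam, hle⟩ := exists_integral_rpow_mul_exp_le hθ
    (show (0 : ℝ) < 1 / (2 * (K + 1)) by positivity)
  have hψ : ContinuousOn (fun t => Real.exp (-lam * t) * φ t) (Icc 0 T) := by fun_prop
  obtain ⟨τ, hτ, hmax⟩ := isCompact_Icc.exists_isMaxOn (nonempty_Icc.2 hT) hψ
  set A := Real.exp (-lam * τ) * φ τ with hA
  have hA0 : 0 ≤ A := mul_nonneg (Real.exp_pos _).le (hφ0 τ hτ)
  have hbd : ∀ s ∈ Icc 0 T, φ s ≤ A * Real.exp (lam * s) := by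
    intro s hs
    have h1 : Real.exp (-lam * s) * φ s ≤ A := hmax hs
    have h2 : Real.exp (-lam * s) * Real.exp (lam * s) = 1 := by
      rw [← Real.exp_add]; simp
    have h3 := mul_le_mul_of_nonneg_right h1 (Real.exp_pos (lam * s)).le
    rwa [mul_right_comm, h2, one_mul] at h3
  have hint : ∫ s in (0 : ℝ)..τ, (τ - s) ^ (θ - 1) * φ s ≤
      A * Real.exp (lam * τ) *
        ∫ s in (0 : ℝ)..τ, (τ - s) ^ (θ - 1) * Real.exp (-lam * (τ - s)) := by
    rw [← intervalIntegral.integral_const_mul]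
    refine intervalIntegral.integral_mono_on hτ.1 ?_ ?_ ?_
    · refine (intervalIntegrable_sub_rpow hθ 0 τ τ).mul_continuousOn ?_
      rw [uIcc_of_le hτ.1]
      exact hφ.mono (Icc_subset_Icc_right hτ.2)
    · refine ((intervalIntegrable_sub_rpow hθ 0 τ τ).mul_continuousOn ?_).const_mul _
      fun_prop
    · intro s hs
      have h1 := hbd s ⟨hs.1, hs.2.trans hτ.2⟩
      have h2 : (0 : ℝ) ≤ (τ - s) ^ (θ - 1) := Real.rpow_nonneg (sub_nonneg.2 hs.2) _
      have h3 : Real.exp (lam * s) = Real.exp (lam * τ) * Real.exp (-lam * (τ - s)) := by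
        rw [← Real.exp_add]; ring_nf
      calc (τ - s) ^ (θ - 1) * φ s ≤ (τ - s) ^ (θ - 1) * (A * Real.exp (lam * s)) := by gcongr
        _ = _ := by rw [h3]; ring
  have h1 := h τ hτ
  have h2 := hle τ hτ.1
  have hAK : A ≤ A / 2 := by
    have hE : Real.exp (-lam * τ) * Real.exp (lam * τ) = 1 := by rw [← Real.exp_add]; simp
    calc A ≤ Real.exp (-lam * τ) * (K * (A * Real.exp (lam * τ) * (1 / (2 * (K + 1))))) := by
          rw [hA]
          refine mul_le_mul_of_nonneg_left (h1.trans ?_) (Real.exp_pos _).le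
          refine mul_le_mul_of_nonneg_left (hint.trans ?_) hK
          exact mul_le_mul_of_nonneg_left h2 (by positivity)
      _ = A * (K / (2 * (K + 1))) * (Real.exp (-lam * τ) * Real.exp (lam * τ)) := by
          field_simp
      _ ≤ A / 2 := by
          rw [hE, mul_one, div_eq_mul_inv A 2]
          refine mul_le_mul_of_nonneg_left ?_ hA0
          rw [div_le_iff₀ (by positivity)]
          linarith
  have hA00 : A = 0 := by linarith
  intro t ht
  have := hbd t ht
  rw [hA00, zero_mul] at this
  exact le_antisymm this (hφ0 t ht)

/-- The abstract mild formulation `w t = g t + ∫₀ᵗ S (t - s) (N s (w s)) ds` on `[0, T]`. -/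
def IsAbstractMild (S : ℝ → Y →L[ℝ] E) (N : ℝ → E → Y) (g : ℝ → E) (T : ℝ) (w : ℝ → E) : Prop :=
  ContinuousOn w (Icc 0 T) ∧
    ∀ t ∈ Icc 0 T, w t = g t + ∫ s in (0 : ℝ)..t, S (t - s) (N s (w s))

/-- The Lipschitz constant is taken on a ball containing both paths, so neither needs to be small or
close to `g`. The norm of the difference then falls under the singular Grönwall lemma. -/
lemma IsAbstractMild.eqOn {S : ℝ → Y →L[ℝ] E} (hS : ContinuousOn S (Ioi 0)) {N : ℝ → E → Y}
    {g : ℝ → E} {T θ C : ℝ} (hT : 0 ≤ T) (hθ : 0 < θ) (hC : 0 ≤ C)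
    (hSb : ∀ r ∈ Ioc 0 T, ‖S r‖ ≤ C * r ^ (θ - 1))
    (hN : ∀ w : ℝ → E, ContinuousOn w (Icc 0 T) → ContinuousOn (fun s => N s (w s)) (Icc 0 T))
    (hLip : ∀ R, ∃ L, ∀ s ∈ Icc 0 T, ∀ x y, ‖x‖ ≤ R → ‖y‖ ≤ R → ‖N s x - N s y‖ ≤ L * ‖x - y‖)
    {w w' : ℝ → E} (hw : IsAbstractMild S N g T w) (hw' : IsAbstractMild S N g T w') :
    EqOn w' w (Icc 0 T) := by
  obtain ⟨R₁, hR₁⟩ := isCompact_Icc.exists_bound_of_continuousOn hw.1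
  obtain ⟨R₂, hR₂⟩ := isCompact_Icc.exists_bound_of_continuousOn hw'.1
  obtain ⟨L, hL⟩ := hLip (max R₁ R₂)
  have hd : ∀ s ∈ Icc 0 T, ‖N s (w' s) - N s (w s)‖ ≤ |L| * ‖w' s - w s‖ := fun s hs =>
    (hL s hs _ _ ((hR₂ s hs).trans (le_max_right _ _)) ((hR₁ s hs).trans (le_max_left _ _))).trans
      (by gcongr; exact le_abs_self L)
  have hc : ContinuousOn (fun s => ‖w' s - w s‖) (Icc 0 T) := (hw'.1.sub hw.1).norm
  have hz := eq_zero_of_le_singular_integral (K := C * |L|) hT hθ (by positivity) hc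
    (fun _ _ => norm_nonneg _) fun t ht => by
      have h1 : w' t - w t = ∫ s in (0 : ℝ)..t, S (t - s) (N s (w' s) - N s (w s)) := by
        simp only [map_sub]
        rw [intervalIntegral.integral_sub
          (intervalIntegrable_convolution hS hθ hSb (hN w' hw'.1) ht)
          (intervalIntegrable_convolution hS hθ hSb (hN w hw.1) ht), hw.2 t ht, hw'.2 t ht]
        abel
      have h2 := norm_convolution_le hθ hSb (hc.const_mul |L|) hd ht
      rw [h1]
      refine h2.trans_eq ?_
      simp_rw [mul_left_comm _ |L|]
      rw [intervalIntegral.integral_const_mul, mul_assoc C]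
  intro t ht
  exact sub_eq_zero.1 (norm_eq_zero.1 (hz t ht))

/-- Picard iteration in the closed unit ball of `C([0,T'];E)` centred at `g`. Both smallness
conditions on `T'` come from `T' ^ θ / θ → 0`. -/
theorem exists_isAbstractMild [CompleteSpace E] {S : ℝ → Y →L[ℝ] E} (hS : ContinuousOn S (Ioi 0))
    {N : ℝ → E → Y} {g : ℝ → E} {T θ C : ℝ} (hT : 0 < T) (hθ : 0 < θ) (hC : 0 ≤ C)
    (hSb : ∀ r ∈ Ioc 0 T, ‖S r‖ ≤ C * r ^ (θ - 1))
    (hN : ∀ T' ≤ T, ∀ w : ℝ → E, ContinuousOn w (Icc 0 T') →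
      ContinuousOn (fun s => N s (w s)) (Icc 0 T'))
    (hLip : ∀ R, ∃ L, ∀ s ∈ Icc 0 T, ∀ x y, ‖x‖ ≤ R → ‖y‖ ≤ R → ‖N s x - N s y‖ ≤ L * ‖x - y‖)
    (hg : ContinuousOn g (Icc 0 T)) :
    ∃ T', 0 < T' ∧ T' ≤ T ∧ ∃ w, IsAbstractMild S N g T' w := by
  obtain ⟨G, hG⟩ := isCompact_Icc.exists_bound_of_continuousOn hg
  obtain ⟨B, hB⟩ := isCompact_Icc.exists_bound_of_continuousOn (hN T le_rfl g hg)
  obtain ⟨L', hL'⟩ := hLip (G + 1)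
  set L := |L'| with hLdef
  have hL : ∀ s ∈ Icc 0 T, ∀ x y, ‖x‖ ≤ G + 1 → ‖y‖ ≤ G + 1 → ‖N s x - N s y‖ ≤ L * ‖x - y‖ :=
    fun s hs x y hx hy => (hL' s hs x y hx hy).trans (by gcongr; exact le_abs_self _)
  have hL0 : 0 ≤ L := abs_nonneg _
  have hB0 : 0 ≤ B := (norm_nonneg _).trans (hB 0 ⟨le_rfl, hT.le⟩)
  -- Bound for the nonlinearity on the unit ball: its size along `g`, plus `L` times the radius.
  set M := B + L with hM
  have hM0 : 0 ≤ M := by positivity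
  obtain ⟨T', ⟨hT'0, hT'T⟩, hsmall1, hsmall2⟩ : ∃ T', (0 < T' ∧ T' ≤ T) ∧
      C * M * (T' ^ θ / θ) ≤ 1 ∧ C * L * (T' ^ θ / θ) ≤ 1 / 2 := by
    have hlim : Tendsto (fun x : ℝ => x ^ θ / θ) (𝓝[>] 0) (𝓝 0) := by
      have : Tendsto (fun x : ℝ => x ^ θ / θ) (𝓝 0) (𝓝 ((0 : ℝ) ^ θ / θ)) :=
        ((Real.continuousAt_rpow_const 0 θ (Or.inr hθ.le)).div_const θ)
      rw [Real.zero_rpow hθ.ne', zero_div] at this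
      exact this.mono_left nhdsWithin_le_nhds
    have h1 : Tendsto (fun x : ℝ => C * M * (x ^ θ / θ)) (𝓝[>] 0) (𝓝 0) := by
      simpa using hlim.const_mul (C * M)
    have h2 : Tendsto (fun x : ℝ => C * L * (x ^ θ / θ)) (𝓝[>] 0) (𝓝 0) := by
      simpa using hlim.const_mul (C * L)
    have h3 : ∀ᶠ x : ℝ in 𝓝[>] 0, 0 < x ∧ x ≤ T := Ioc_mem_nhdsGT hT
    exact (h3.and ((h1.eventually (ge_mem_nhds one_pos)).and
      (h2.eventually (ge_mem_nhds (by norm_num))))).exists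
  have hsub : Icc 0 T' ⊆ Icc 0 T := Icc_subset_Icc_right hT'T
  have hSb' : ∀ r ∈ Ioc 0 T', ‖S r‖ ≤ C * r ^ (θ - 1) := fun r hr => hSb r ⟨hr.1, hr.2.trans hT'T⟩
  let ext : C(Icc 0 T', E) → ℝ → E := fun w => IccExtend hT'0.le w
  have hext : ∀ w, Continuous (ext w) := fun w => w.continuous.Icc_extend'
  have hextmem : ∀ w (t : ℝ) (ht : t ∈ Icc 0 T'), ext w t = w ⟨t, ht⟩ := fun w t ht =>
    IccExtend_of_mem _ _ ht
  let Φ₀ : C(Icc 0 T', E) → ℝ → E := fun w t =>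
    g t + ∫ s in (0 : ℝ)..t, S (t - s) (N s (ext w s))
  have hΦ₀ : ∀ w, ContinuousOn (Φ₀ w) (Icc 0 T') := fun w => (hg.mono hsub).add
    (continuousOn_convolution hS hT'0.le hθ hSb' (hN T' hT'T _ (hext w).continuousOn))
  let Φ : C(Icc 0 T', E) → C(Icc 0 T', E) := fun w =>
    ⟨(Icc 0 T').domRestrict (Φ₀ w), continuousOn_iff_continuous_domRestrict.1 (hΦ₀ w)⟩
  let g' : C(Icc 0 T', E) :=
    ⟨(Icc 0 T').domRestrict g, continuousOn_iff_continuous_domRestrict.1 (hg.mono hsub)⟩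
  let s : Set C(Icc 0 T', E) := Metric.closedBall g' 1
  have hpow : ∀ t ∈ Icc 0 T', t ^ θ / θ ≤ T' ^ θ / θ := fun t ht => by
    have := Real.rpow_le_rpow ht.1 ht.2 hθ.le
    gcongr
  have hball : ∀ w ∈ s, ∀ t ∈ Icc 0 T', ‖ext w t - g t‖ ≤ 1 := by
    intro w hw t ht
    have h1 : dist (w ⟨t, ht⟩) (g' ⟨t, ht⟩) ≤ 1 := (ContinuousMap.dist_apply_le_dist _).trans hw
    rw [hextmem w t ht, ← dist_eq_norm]
    exact h1
  have hballn : ∀ w ∈ s, ∀ t ∈ Icc 0 T', ‖ext w t‖ ≤ G + 1 := by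
    intro w hw t ht
    have h1 := hball w hw t ht
    have h2 := hG t (hsub ht)
    calc ‖ext w t‖ = ‖g t + (ext w t - g t)‖ := by congr 1; abel
      _ ≤ G + 1 := (norm_add_le _ _).trans (add_le_add h2 h1)
  have hNb : ∀ w ∈ s, ∀ t ∈ Icc 0 T', ‖N t (ext w t)‖ ≤ M := by
    intro w hw t ht
    have h1 := hL t (hsub ht) (ext w t) (g t) (hballn w hw t ht)
      ((hG t (hsub ht)).trans (by linarith))
    have h2 := hB t (hsub ht)
    have h3 := hball w hw t ht
    calc ‖N t (ext w t)‖ = ‖N t (g t) + (N t (ext w t) - N t (g t))‖ := by congr 1; abel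
      _ ≤ B + L * 1 := (norm_add_le _ _).trans (add_le_add h2 (h1.trans (by gcongr)))
      _ = M := by rw [mul_one]
  have hmaps : MapsTo Φ s s := by
    intro w hw
    rw [Metric.mem_closedBall, ContinuousMap.dist_le zero_le_one]
    rintro ⟨t, ht⟩
    have h1 := norm_convolution_le_const hθ hSb' (hNb w hw) ht
    rw [dist_eq_norm]
    have h2 : Φ w ⟨t, ht⟩ - g' ⟨t, ht⟩ = ∫ s in (0 : ℝ)..t, S (t - s) (N s (ext w s)) := by
      change (g t + _) - g t = _
      abel
    rw [h2]
    refine h1.trans (le_trans ?_ hsmall1)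
    exact mul_le_mul_of_nonneg_left (hpow t ht) (by positivity)
  have hcontr : ∀ w₁ ∈ s, ∀ w₂ ∈ s, dist (Φ w₁) (Φ w₂) ≤ 1 / 2 * dist w₁ w₂ := by
    intro w₁ h₁ w₂ h₂
    rw [ContinuousMap.dist_le (by positivity)]
    rintro ⟨t, ht⟩
    have h3 : Φ w₁ ⟨t, ht⟩ - Φ w₂ ⟨t, ht⟩ =
        ∫ s in (0 : ℝ)..t, S (t - s) (N s (ext w₁ s) - N s (ext w₂ s)) := by
      simp only [map_sub]
      rw [intervalIntegral.integral_sub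
        (intervalIntegrable_convolution hS hθ hSb' (hN T' hT'T _ (hext w₁).continuousOn) ht)
        (intervalIntegrable_convolution hS hθ hSb' (hN T' hT'T _ (hext w₂).continuousOn) ht)]
      change (g t + _) - (g t + _) = _
      abel
    have h4 : ∀ r ∈ Icc 0 T', ‖N r (ext w₁ r) - N r (ext w₂ r)‖ ≤ L * dist w₁ w₂ := by
      intro r hr
      refine (hL r (hsub hr) _ _ (hballn w₁ h₁ r hr) (hballn w₂ h₂ r hr)).trans ?_
      rw [hextmem w₁ r hr, hextmem w₂ r hr, ← dist_eq_norm]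
      gcongr
      exact ContinuousMap.dist_apply_le_dist _
    rw [dist_eq_norm, h3]
    refine (norm_convolution_le_const hθ hSb' h4 ht).trans ?_
    calc C * (L * dist w₁ w₂) * (t ^ θ / θ) ≤ C * (L * dist w₁ w₂) * (T' ^ θ / θ) :=
          mul_le_mul_of_nonneg_left (hpow t ht) (by positivity)
      _ = C * L * (T' ^ θ / θ) * dist w₁ w₂ := by ring
      _ ≤ _ := by gcongr
  have hcw : ContractingWith (1 / 2 : NNReal) (hmaps.restrict Φ s s) := by
    refine ⟨by norm_num, LipschitzWith.of_dist_le_mul fun x y => ?_⟩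
    exact hcontr x x.2 y y.2
  obtain ⟨w, -, hfix, -⟩ := hcw.exists_fixedPoint' (Metric.isClosed_closedBall.isComplete) hmaps
    (x := g') (Metric.mem_closedBall_self zero_le_one) (edist_ne_top _ _)
  refine ⟨T', hT'0, hT'T, ext w, (hext w).continuousOn, fun t ht => ?_⟩
  have h5 : Φ w ⟨t, ht⟩ = w ⟨t, ht⟩ := congrArg (fun u : C(Icc 0 T', E) => u ⟨t, ht⟩) hfix
  rw [hextmem w t ht, ← h5]
  rfl

end AbstractMild

/-! ### Sobolev weights and decay of the heat symbol -/

lemma one_le_one_add_sq (k : ℤ) : (1 : ℝ) ≤ 1 + (k : ℝ) ^ 2 := by nlinarith [sq_nonneg (k : ℝ)]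

lemma one_add_sq_pos (k : ℤ) : (0 : ℝ) < 1 + (k : ℝ) ^ 2 := by positivity

lemma summable_one_add_sq_rpow {s : ℝ} (hs : s < -(1 / 2)) :
    Summable fun k : ℤ => (1 + (k : ℝ) ^ 2) ^ s := by
  -- The comparison series vanishes at `k = 0`, since `0` to a nonzero power is `0`, while the
  -- weight there is `1`; the indicator of `0` makes up for it.
  have h := (Real.summable_abs_int_rpow (b := -(2 * s)) (by linarith)).add
    (hasSum_ite_eq (0 : ℤ) (1 : ℝ)).summable
  refine Summable.of_nonneg_of_le (fun k => by positivity) (fun k => ?_) h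
  by_cases hk : k = 0
  · subst hk
    have : (0 : ℝ) ≤ |((0 : ℤ) : ℝ)| ^ (-(-(2 * s))) := by positivity
    simp only [Int.cast_zero, if_true]
    simp only [Int.cast_zero] at this
    norm_num
    simpa using this
  · have hk' : (k : ℝ) ≠ 0 := by exact_mod_cast hk
    have h1 : |(k : ℝ)| ^ (-(-(2 * s))) = ((k : ℝ) ^ 2) ^ s := by
      rw [neg_neg, Real.rpow_mul (abs_nonneg _), ← sq_abs]
      norm_num
    rw [if_neg hk, add_zero, h1]
    exact Real.rpow_le_rpow_of_nonpos (by positivity) (by linarith) (by linarith)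

/-- Raise `x / a ≤ e^{x/a}` to the power `a`. -/
lemma exists_exp_neg_le (a : ℝ) (ha : 0 ≤ a) :
    ∃ C, 0 < C ∧ ∀ x, 0 < x → Real.exp (-x) ≤ C * x ^ (-a) := by
  rcases ha.eq_or_lt with rfl | ha
  · exact ⟨1, one_pos, fun x hx => by simpa using hx.le⟩
  refine ⟨a ^ a, by positivity, fun x hx => ?_⟩
  have h1 : x / a ≤ Real.exp (x / a) := by linarith [Real.add_one_le_exp (x / a)]
  have h2 : (x / a) ^ a ≤ Real.exp x := by
    calc (x / a) ^ a ≤ Real.exp (x / a) ^ a := Real.rpow_le_rpow (by positivity) h1 ha.le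
      _ = Real.exp x := by rw [← Real.exp_mul]; congr 1; field_simp
  rw [Real.exp_neg, Real.rpow_neg hx.le, ← div_eq_mul_inv, inv_le_comm₀ (Real.exp_pos x) (by positivity),
    inv_div, ← Real.div_rpow hx.le ha.le]
  exact h2

/-- The symbol of the heat semigroup decays faster than any power of the frequency. -/
lemma exists_heat_symbol_le (T a : ℝ) (ha : 0 ≤ a) :
    ∃ C, 0 < C ∧ ∀ r ∈ Ioc 0 T, ∀ k : ℤ,
      Real.exp (-r * (k : ℝ) ^ 2) ≤ C * r ^ (-a) * (1 + (k : ℝ) ^ 2) ^ (-a) := by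
  obtain ⟨C, hC, h⟩ := exists_exp_neg_le a ha
  -- The factor `e^T` pays for replacing `k²` by `1 + k²`, which includes the mode `k = 0`.
  refine ⟨Real.exp T * C, by positivity, fun r hr k => ?_⟩
  have h1 := h (r * (1 + (k : ℝ) ^ 2)) (mul_pos hr.1 (one_add_sq_pos k))
  rw [Real.mul_rpow hr.1.le (one_add_sq_pos k).le] at h1
  calc Real.exp (-r * (k : ℝ) ^ 2) = Real.exp r * Real.exp (-(r * (1 + (k : ℝ) ^ 2))) := by
        rw [← Real.exp_add]; ring_nf
    _ ≤ Real.exp T * (C * (r ^ (-a) * (1 + (k : ℝ) ^ 2) ^ (-a))) := by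
        gcongr
        exact hr.2
    _ = _ := by ring

lemma sqrt_weight_eq (k : ℤ) : √(1 + (k : ℝ) ^ 2) = (1 + (k : ℝ) ^ 2) ^ (1 / 2 : ℝ) :=
  Real.sqrt_eq_rpow _

lemma summable_heat_symbol {r : ℝ} (hr : 0 < r) (s : ℝ) :
    Summable fun k : ℤ => Real.exp (-r * (k : ℝ) ^ 2) * (1 + (k : ℝ) ^ 2) ^ s := by
  obtain ⟨C, -, h⟩ := exists_heat_symbol_le r (|s| + 1) (by positivity)
  refine Summable.of_nonneg_of_le (fun k => by positivity) (fun k => ?_)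
    ((summable_one_add_sq_rpow (s := s - (|s| + 1)) (by linarith [le_abs_self s])).mul_left
      (C * r ^ (-(|s| + 1))))
  refine (mul_le_mul_of_nonneg_right (h r ⟨hr, le_rfl⟩ k) (by positivity)).trans_eq ?_
  rw [mul_assoc, ← Real.rpow_add (one_add_sq_pos k)]
  ring_nf

/-! ### Fourier coefficients of real functions -/

lemma memLp_ofReal_haar {q : ℝ≥0∞} {f : Torus → ℝ} (hf : MemLp f q volume) :
    MemLp (fun x => (f x : ℂ)) q AddCircle.haarAddCircle :=
  memLp_haarAddCircle_iff.2 hf.ofReal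

lemma integrable_ofReal_haar {f : Torus → ℝ} (hf : Integrable f volume) :
    Integrable (fun x => (f x : ℂ)) AddCircle.haarAddCircle :=
  memLp_one_iff_integrable.1 (memLp_ofReal_haar (memLp_one_iff_integrable.2 hf))

lemma haar_absolutelyContinuous_volume :
    (AddCircle.haarAddCircle : Measure Torus) ≪ volume := by
  rw [AddCircle.volume_eq_smul_haarAddCircle]
  exact Measure.absolutelyContinuous_smul (by simp [Real.pi_pos])

lemma coeff_congr_ae {f g : Torus → ℝ} (h : f =ᵐ[volume] g) : coeff f = coeff g := by
  have h' : (fun x => (f x : ℂ)) =ᵐ[AddCircle.haarAddCircle] fun x => (g x : ℂ) := by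
    filter_upwards [haar_absolutelyContinuous_volume.ae_le h] with x hx
    rw [hx]
  exact fourierCoeff_congr_ae h'

lemma coeff_add {f g : Torus → ℝ} (hf : Integrable f volume) (hg : Integrable g volume) (k : ℤ) :
    coeff (fun x => f x + g x) k = coeff f k + coeff g k := by
  have := congrFun (fourierCoeff.add (integrable_ofReal_haar hf) (integrable_ofReal_haar hg)) k
  simpa [coeff, Pi.add_def] using this

lemma coeff_const_mul (f : Torus → ℝ) (c : ℝ) (k : ℤ) :
    coeff (fun x => c * f x) k = c * coeff f k := by
  have := fourierCoeff.const_mul (fun x : Torus => (f x : ℂ)) c k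
  simpa [coeff] using this

lemma norm_fourier_apply (k : ℤ) (x : Torus) : ‖(fourier k : C(Torus, ℂ)) x‖ = 1 :=
  Circle.norm_coe _

lemma norm_coeff_le (f : Torus → ℝ) (k : ℤ) :
    ‖coeff f k‖ ≤ (2 * π)⁻¹ * ∫ x, ‖f x‖ := by
  have h := norm_integral_le_integral_norm (μ := (AddCircle.haarAddCircle : Measure Torus))
    (fun x => fourier (-k) x • (f x : ℂ))
  refine h.trans_eq ?_
  rw [AddCircle.integral_haarAddCircle]
  rw [smul_eq_mul]
  congr 1
  refine integral_congr_ae (Eventually.of_forall fun x => ?_)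
  simp only [norm_smul, norm_fourier_apply, one_mul, Complex.norm_real]

lemma coeff_neg_eq_conj (f : Torus → ℝ) (k : ℤ) :
    coeff f (-k) = (starRingEnd ℂ) (coeff f k) := by
  unfold coeff fourierCoeff
  rw [← integral_conj]
  refine integral_congr_ae (Eventually.of_forall fun x => ?_)
  simp only [smul_eq_mul, map_mul, Complex.conj_ofReal, fourier_neg, Complex.conj_conj]

lemma hasSum_sq_coeff {f : Torus → ℝ} (hf : MemLp f 2 volume) :
    HasSum (fun k => ‖coeff f k‖ ^ 2) ((2 * π)⁻¹ * ∫ x, f x ^ 2) := by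
  have hf' := memLp_ofReal_haar hf
  have h := hasSum_sq_fourierCoeff (hf'.toLp _)
  have e1 : fourierCoeff (hf'.toLp _) = coeff f := fourierCoeff_congr_ae hf'.coeFn_toLp
  have e2 : ∫ t : Torus, ‖hf'.toLp _ t‖ ^ 2 ∂AddCircle.haarAddCircle = (2 * π)⁻¹ * ∫ x, f x ^ 2 := by
    refine Eq.trans ?_ AddCircle.integral_haarAddCircle
    refine integral_congr_ae ?_
    filter_upwards [hf'.coeFn_toLp] with x hx
    rw [hx]
    simp
  rwa [e1, e2] at h

/-! ### Inclusions between Lebesgue spaces and coefficient functionals -/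

/-- The inclusion `L^q ⊆ L^p` for `p ≤ q`. -/
def lpInclusion {p q : ℝ≥0∞} [Fact (1 ≤ p)] [Fact (1 ≤ q)] (h : p ≤ q) : LpT q →L[ℝ] LpT p :=
  LinearMap.mkContinuous
    { toFun := fun f => ((Lp.memLp f).mono_exponent h).toLp f
      map_add' := fun f g => by
        rw [← MemLp.toLp_add]
        exact MemLp.toLp_congr _ _ (Lp.coeFn_add f g)
      map_smul' := fun c f => by
        rw [RingHom.id_apply, ← MemLp.toLp_const_smul]
        exact MemLp.toLp_congr _ _ (Lp.coeFn_smul c f) }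
    ((volume (univ : Set Torus)) ^ (1 / p.toReal - 1 / q.toReal)).toReal fun f => by
      simp only [LinearMap.coe_mk, AddHom.coe_mk, Lp.norm_toLp]
      rw [Lp.norm_def, mul_comm (ENNReal.toReal _), ← ENNReal.toReal_mul]
      have hle := eLpNorm_le_eLpNorm_mul_rpow_measure_univ h (Lp.memLp f).1
      refine ENNReal.toReal_mono (ENNReal.mul_ne_top (Lp.eLpNorm_ne_top f) ?_) hle
      exact ENNReal.rpow_ne_top_of_nonneg' (by simp [Real.pi_pos]) (measure_ne_top _ _)

lemma coeFn_lpInclusion {p q : ℝ≥0∞} [Fact (1 ≤ p)] [Fact (1 ≤ q)] (h : p ≤ q) (f : LpT q) :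
    lpInclusion h f =ᵐ[volume] f :=
  MemLp.coeFn_toLp ((Lp.memLp f).mono_exponent h)

lemma integrable_coeFn {q : ℝ≥0∞} [Fact (1 ≤ q)] (f : LpT q) : Integrable f volume :=
  memLp_one_iff_integrable.1 ((Lp.memLp f).mono_exponent Fact.out)

lemma integral_norm_eq_norm (f : LpT 1) : ∫ x, ‖f x‖ = ‖f‖ := (L1.norm_eq_integral_norm f).symm

/-- The `k`-th Fourier coefficient as a functional on `L¹`. -/
def coeffL1 (k : ℤ) : LpT 1 →L[ℝ] ℂ :=
  LinearMap.mkContinuous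
    { toFun := fun f => coeff f k
      map_add' := fun f g => by
        rw [coeff_congr_ae (Lp.coeFn_add f g)]
        exact coeff_add (integrable_coeFn f) (integrable_coeFn g) k
      map_smul' := fun c f => by
        rw [coeff_congr_ae (Lp.coeFn_smul c f)]
        exact coeff_const_mul f c k }
    (2 * π)⁻¹ fun f => by
      rw [← integral_norm_eq_norm]
      exact norm_coeff_le f k

/-- The `k`-th Fourier coefficient as a functional on `L^q`. -/
def coeffCLM (q : ℝ≥0∞) [Fact (1 ≤ q)] (k : ℤ) : LpT q →L[ℝ] ℂ :=
  (coeffL1 k).comp (lpInclusion Fact.out)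

lemma coeffCLM_apply (q : ℝ≥0∞) [Fact (1 ≤ q)] (k : ℤ) (f : LpT q) :
    coeffCLM q k f = coeff f k :=
  congrFun (coeff_congr_ae (coeFn_lpInclusion Fact.out f)) k

lemma exists_norm_coeff_le (q : ℝ≥0∞) [Fact (1 ≤ q)] :
    ∃ D, 0 ≤ D ∧ ∀ (f : LpT q) (k : ℤ), ‖coeff f k‖ ≤ D * ‖f‖ := by
  refine ⟨(2 * π)⁻¹ * ‖(lpInclusion Fact.out : LpT q →L[ℝ] LpT 1)‖, by positivity, fun f k => ?_⟩
  rw [← coeff_congr_ae (coeFn_lpInclusion (p := 1) Fact.out f), mul_assoc]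
  refine (norm_coeff_le _ k).trans ?_
  rw [integral_norm_eq_norm]
  gcongr
  exact ContinuousLinearMap.le_opNorm _ _

/-! ### Smoothing Fourier multipliers -/

/-- Pointwise real part. -/
def reMap : C(Torus, ℂ) →L[ℝ] C(Torus, ℝ) :=
  Complex.reCLM.compLeftContinuous ℝ Torus

@[simp] lemma reMap_apply (G : C(Torus, ℂ)) (x : Torus) : reMap G x = (G x).re := rfl

lemma norm_reMap_le (G : C(Torus, ℂ)) : ‖reMap G‖ ≤ ‖G‖ :=
  (ContinuousMap.norm_le _ (norm_nonneg _)).2 fun x =>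
    (Complex.abs_re_le_norm _).trans (G.norm_coe_le_norm x)

/-- The complex valued sum `∑ₖ e^{-t k²} a k e^{i k x}`. -/
def heatSeries (t : ℝ) (a : ℤ → ℂ) : C(Torus, ℂ) :=
  ∑' k : ℤ, ((Real.exp (-t * (k : ℝ) ^ 2) : ℂ) * a k) • (fourier k : C(Torus, ℂ))

lemma heatSmooth_eq (t : ℝ) (a : ℤ → ℂ) : heatSmooth t a = reMap (heatSeries t a) := rfl

/-- Symbols bounded by `(1 + k²)^{1/2}`, as those of the identity and of `∂ₓ`. -/
def IsFirstOrder (a : ℤ → ℂ) : Prop := ∃ A, ∀ k, ‖a k‖ ≤ A * (1 + (k : ℝ) ^ 2) ^ (1 / 2 : ℝ)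

lemma norm_intCast_le (k : ℤ) : |(k : ℝ)| ≤ (1 + (k : ℝ) ^ 2) ^ (1 / 2 : ℝ) := by
  rw [← sqrt_weight_eq]
  exact Real.abs_le_sqrt (by linarith)

lemma norm_heat_term (t : ℝ) (a : ℤ → ℂ) (k : ℤ) :
    ‖((Real.exp (-t * (k : ℝ) ^ 2) : ℂ) * a k) • (fourier k : C(Torus, ℂ))‖ =
      Real.exp (-t * (k : ℝ) ^ 2) * ‖a k‖ := by
  rw [norm_smul, fourier_norm, mul_one, norm_mul, Complex.norm_real, Real.norm_eq_abs,
    abs_of_pos (Real.exp_pos _)]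

lemma IsFirstOrder.summable {a : ℤ → ℂ} (ha : IsFirstOrder a) {t : ℝ} (ht : 0 < t) :
    Summable fun k : ℤ => Real.exp (-t * (k : ℝ) ^ 2) * ‖a k‖ := by
  obtain ⟨A, hA⟩ := ha
  refine Summable.of_nonneg_of_le (fun k => by positivity) (fun k => ?_)
    ((summable_heat_symbol ht (1 / 2)).mul_left A)
  calc _ ≤ Real.exp (-t * (k : ℝ) ^ 2) * (A * (1 + (k : ℝ) ^ 2) ^ (1 / 2 : ℝ)) := by
        gcongr
        exact hA k
    _ = _ := by ring

lemma hasSum_heatSeries {t : ℝ} {a : ℤ → ℂ}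
    (h : Summable fun k : ℤ => Real.exp (-t * (k : ℝ) ^ 2) * ‖a k‖) :
    HasSum (fun k : ℤ => ((Real.exp (-t * (k : ℝ) ^ 2) : ℂ) * a k) • (fourier k : C(Torus, ℂ)))
      (heatSeries t a) := by
  refine Summable.hasSum (Summable.of_norm ?_)
  simpa only [norm_heat_term] using h

lemma norm_heatSmooth_le {t : ℝ} {a : ℤ → ℂ}
    (h : Summable fun k : ℤ => Real.exp (-t * (k : ℝ) ^ 2) * ‖a k‖) :
    ‖heatSmooth t a‖ ≤ ∑' k : ℤ, Real.exp (-t * (k : ℝ) ^ 2) * ‖a k‖ := by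
  rw [heatSmooth_eq]
  refine (norm_reMap_le _).trans ?_
  refine (norm_tsum_le_tsum_norm ?_).trans_eq ?_
  · simpa only [norm_heat_term] using h
  · simp only [norm_heat_term]

lemma fourierCoeff_fourier (n k : ℤ) :
    fourierCoeff (fourier n : C(Torus, ℂ)) k = if n = k then 1 else 0 := by
  have h := (orthonormal_iff_ite.1 (orthonormal_fourier (T := 2 * π))) k n
  rw [ContinuousMap.inner_toLp] at h
  rw [fourierCoeff]
  simp only [smul_eq_mul, fourier_neg]
  rw [show (if n = k then (1 : ℂ) else 0) = if k = n then 1 else 0 by simp only [eq_comm], ← h]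
  refine integral_congr_ae (Eventually.of_forall fun x => ?_)
  simp only [mul_comm]

/-- The Fourier coefficient as a functional on continuous functions. -/
def coeffCont (k : ℤ) : C(Torus, ℂ) →L[ℂ] ℂ :=
  LinearMap.mkContinuous
    { toFun := fun f => fourierCoeff f k
      map_add' := fun f g => by
        have hi : ∀ f : C(Torus, ℂ), Integrable f AddCircle.haarAddCircle := fun f =>
          f.continuous.integrable_of_hasCompactSupport (HasCompactSupport.of_compactSpace _)
        exact congrFun (fourierCoeff.add (hi f) (hi g)) k
      map_smul' := fun c f => fourierCoeff.const_smul f c k }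
    1 fun f => by
      simp only [LinearMap.coe_mk, AddHom.coe_mk, one_mul]
      have := norm_integral_le_of_norm_le_const (μ := (AddCircle.haarAddCircle : Measure Torus))
        (f := fun t => fourier (-k) t • f t) (C := ‖f‖) (Eventually.of_forall fun x => by
          rw [norm_smul, norm_fourier_apply, one_mul]
          exact f.norm_coe_le_norm x)
      simpa [fourierCoeff] using this

@[simp] lemma coeffCont_apply (k : ℤ) (f : C(Torus, ℂ)) : coeffCont k f = fourierCoeff f k := rfl

lemma fourierCoeff_heatSeries {t : ℝ} {a : ℤ → ℂ}
    (h : Summable fun k : ℤ => Real.exp (-t * (k : ℝ) ^ 2) * ‖a k‖) (k : ℤ) :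
    fourierCoeff (heatSeries t a) k = (Real.exp (-t * (k : ℝ) ^ 2) : ℂ) * a k := by
  have h1 := (hasSum_heatSeries h).mapL (coeffCont k)
  refine h1.unique ?_
  convert hasSum_ite_eq k ((Real.exp (-t * (k : ℝ) ^ 2) : ℂ) * a k) using 2 with n
  rw [map_smul, coeffCont_apply, fourierCoeff_fourier]
  split_ifs with hnk
  · subst hnk; simp
  · simp

/-- Conjugation exchanges the terms of index `k` and `-k`. Hence the real part in `heatSmooth`
discards nothing, and the Fourier coefficients of `heatSmooth` are exactly the damped ones. -/
lemma conj_heatSeries {t : ℝ} {a : ℤ → ℂ}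
    (h : Summable fun k : ℤ => Real.exp (-t * (k : ℝ) ^ 2) * ‖a k‖)
    (ha : ∀ k, a (-k) = (starRingEnd ℂ) (a k)) (x : Torus) :
    (starRingEnd ℂ) (heatSeries t a x) = heatSeries t a x := by
  have h1 := (hasSum_heatSeries h).mapL (ContinuousMap.evalCLM ℂ x)
  have h2 := h1.mapL (Complex.conjCLE : ℂ →L[ℝ] ℂ)
  have h3 := (Equiv.neg ℤ).hasSum_iff.2 h1
  have h4 : (starRingEnd ℂ) (heatSeries t a x) =
      (Complex.conjCLE : ℂ →L[ℝ] ℂ) (ContinuousMap.evalCLM ℂ x (heatSeries t a)) := rfl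
  rw [h4]
  refine (h3.unique ?_).symm
  convert h2 using 2 with k
  simp only [Function.comp_apply, Equiv.neg_apply, map_smul]
  simp [ha, -fourier_apply, fourier_neg, ContinuousMap.evalCLM, Complex.conj_ofReal, ← Complex.exp_conj]

lemma ofReal_heatSmooth {t : ℝ} {a : ℤ → ℂ}
    (h : Summable fun k : ℤ => Real.exp (-t * (k : ℝ) ^ 2) * ‖a k‖)
    (ha : ∀ k, a (-k) = (starRingEnd ℂ) (a k)) (x : Torus) :
    ((heatSmooth t a x : ℝ) : ℂ) = heatSeries t a x := by
  rw [heatSmooth_eq, reMap_apply]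
  exact (Complex.conj_eq_iff_re.1 (conj_heatSeries h ha x))

lemma coeff_heatSmooth {t : ℝ} {a : ℤ → ℂ}
    (h : Summable fun k : ℤ => Real.exp (-t * (k : ℝ) ^ 2) * ‖a k‖)
    (ha : ∀ k, a (-k) = (starRingEnd ℂ) (a k)) (k : ℤ) :
    coeff (heatSmooth t a) k = (Real.exp (-t * (k : ℝ) ^ 2) : ℂ) * a k := by
  rw [← fourierCoeff_heatSeries h]
  unfold coeff
  congr 1
  ext x
  exact ofReal_heatSmooth h ha x

/-! ### Operator-valued heat series -/

section HeatSum

variable {E F : Type*} [NormedAddCommGroup E] [NormedSpace ℝ E]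
  [NormedAddCommGroup F] [NormedSpace ℝ F]

/-- The operator `∑ₖ e^{-r k²} A k`. -/
def heatSum (A : ℤ → E →L[ℝ] F) (r : ℝ) : E →L[ℝ] F :=
  ∑' k : ℤ, Real.exp (-r * (k : ℝ) ^ 2) • A k

lemma norm_heatSum_term (A : ℤ → E →L[ℝ] F) (r : ℝ) (k : ℤ) :
    ‖Real.exp (-r * (k : ℝ) ^ 2) • A k‖ = Real.exp (-r * (k : ℝ) ^ 2) * ‖A k‖ := by
  rw [norm_smul, Real.norm_eq_abs, abs_of_pos (Real.exp_pos _)]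

variable [CompleteSpace F]

lemma hasSum_heatSum_apply {A : ℤ → E →L[ℝ] F} {r : ℝ}
    (hA : Summable fun k : ℤ => Real.exp (-r * (k : ℝ) ^ 2) * ‖A k‖) (x : E) :
    HasSum (fun k : ℤ => Real.exp (-r * (k : ℝ) ^ 2) • A k x) (heatSum A r x) := by
  have h : HasSum (fun k : ℤ => Real.exp (-r * (k : ℝ) ^ 2) • A k) (heatSum A r) := by
    refine (Summable.of_norm ?_).hasSum
    simpa only [norm_heatSum_term] using hA
  exact h.mapL (ContinuousLinearMap.apply ℝ F x)

/-- Continuity in operator norm by the Weierstrass test: for `r > r₀ / 2` each term is dominated by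
its value at `r₀ / 2`. -/
lemma continuousOn_heatSum {A : ℤ → E →L[ℝ] F}
    (hA : ∀ r, 0 < r → Summable fun k : ℤ => Real.exp (-r * (k : ℝ) ^ 2) * ‖A k‖) :
    ContinuousOn (heatSum A) (Ioi 0) := by
  refine continuousOn_of_forall_continuousAt fun r₀ hr₀ => ?_
  have hpos : 0 < r₀ / 2 := half_pos hr₀
  have hc : ContinuousOn (heatSum A) (Ioi (r₀ / 2)) := by
    refine continuousOn_tsum (fun k => by fun_prop) (hA _ hpos) ?_
    intro k r hr
    rw [norm_heatSum_term]
    have : r₀ / 2 ≤ r := le_of_lt hr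
    gcongr
  exact hc.continuousAt (Ioi_mem_nhds (half_lt_self hr₀))

end HeatSum

section Smoothing

variable (q : ℝ≥0∞) [Fact (1 ≤ q)]

/-- The operator `f ↦ re (c f̂(k) e^{ikx})`. -/
def modeCLM (c : ℂ) (k : ℤ) : LpT q →L[ℝ] C(Torus, ℝ) :=
  reMap.comp ((coeffCLM q k).smulRight (c • (fourier k : C(Torus, ℂ))))

lemma modeCLM_apply (c : ℂ) (k : ℤ) (f : LpT q) :
    modeCLM q c k f = reMap ((c * coeff f k) • (fourier k : C(Torus, ℂ))) := by
  simp only [modeCLM, ContinuousLinearMap.comp_apply, ContinuousLinearMap.smulRight_apply,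
    coeffCLM_apply, smul_smul, mul_comm]

lemma exists_norm_modeCLM_le :
    ∃ D, 0 ≤ D ∧ ∀ c k, ‖modeCLM q c k‖ ≤ D * ‖c‖ := by
  obtain ⟨D, hD, h⟩ := exists_norm_coeff_le q
  refine ⟨D, hD, fun c k => ContinuousLinearMap.opNorm_le_bound _ (by positivity) fun f => ?_⟩
  rw [modeCLM_apply]
  refine (norm_reMap_le _).trans ?_
  rw [norm_smul, fourier_norm, mul_one, norm_mul]
  calc ‖c‖ * ‖coeff f k‖ ≤ ‖c‖ * (D * ‖f‖) := by gcongr; exact h f k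
    _ = _ := by ring

/-- The operator `e^{rΔ} m(D)` from `L^q` to continuous functions, for `r > 0`. -/
def smoothing (m : ℤ → ℂ) (r : ℝ) : LpT q →L[ℝ] C(Torus, ℝ) :=
  heatSum (fun k => modeCLM q (m k) k) r

variable {q}

lemma summable_norm_modes {m : ℤ → ℂ} (hm : IsFirstOrder m) {r : ℝ} (hr : 0 < r) :
    Summable fun k : ℤ => Real.exp (-r * (k : ℝ) ^ 2) * ‖modeCLM q (m k) k‖ := by
  obtain ⟨D, hD, h⟩ := exists_norm_modeCLM_le q
  refine Summable.of_nonneg_of_le (fun k => by positivity) (fun k => ?_)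
    ((hm.summable hr).mul_left D)
  calc _ ≤ Real.exp (-r * (k : ℝ) ^ 2) * (D * ‖m k‖) := by gcongr; exact h _ _
    _ = _ := by ring

lemma continuousOn_smoothing {m : ℤ → ℂ} (hm : IsFirstOrder m) :
    ContinuousOn (smoothing q m) (Ioi 0) :=
  continuousOn_heatSum fun _ hr => summable_norm_modes hm hr

lemma isFirstOrder_mul_coeff {m : ℤ → ℂ} (hm : IsFirstOrder m) (f : LpT q) :
    IsFirstOrder fun k => m k * coeff f k := by
  obtain ⟨A, hA⟩ := hm
  obtain ⟨D, hD, h⟩ := exists_norm_coeff_le q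
  refine ⟨A * (D * ‖f‖), fun k => ?_⟩
  rw [norm_mul]
  calc ‖m k‖ * ‖coeff f k‖ ≤ (A * (1 + (k : ℝ) ^ 2) ^ (1 / 2 : ℝ)) * (D * ‖f‖) := by
        gcongr
        · exact (norm_nonneg _).trans (hA k)
        · exact hA k
        · exact h f k
    _ = _ := by ring

lemma smoothing_apply {m : ℤ → ℂ} (hm : IsFirstOrder m) {r : ℝ} (hr : 0 < r) (f : LpT q) :
    smoothing q m r f = heatSmooth r fun k => m k * coeff f k := by
  have h1 := hasSum_heatSum_apply (summable_norm_modes (q := q) hm hr) f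
  have h2 := (hasSum_heatSeries ((isFirstOrder_mul_coeff hm f).summable hr)).mapL reMap
  rw [heatSmooth_eq]
  have h3 : ∀ k : ℤ, Real.exp (-r * (k : ℝ) ^ 2) • modeCLM q (m k) k f =
      reMap (((Real.exp (-r * (k : ℝ) ^ 2) : ℂ) * (m k * coeff f k)) • fourier k) := by
    intro k
    rw [modeCLM_apply, ← map_smul]
    congr 1
    ext x
    simp [mul_assoc]
  simp only [← h3] at h2
  exact h1.unique h2

end Smoothing

lemma isFirstOrder_one : IsFirstOrder fun _ => 1 :=
  ⟨1, fun k => by simpa using Real.one_le_rpow (one_le_one_add_sq k) (by norm_num)⟩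

lemma isFirstOrder_deriv : IsFirstOrder fun k => Complex.I * k :=
  ⟨1, fun k => by simpa using norm_intCast_le k⟩

lemma derivCoeff_neg_eq_conj (f : Torus → ℝ) (k : ℤ) :
    derivCoeff (coeff f) (-k) = (starRingEnd ℂ) (derivCoeff (coeff f) k) := by
  simp [derivCoeff, coeff_neg_eq_conj]

lemma isFirstOrder_derivCoeff {q : ℝ≥0∞} [Fact (1 ≤ q)] (f : LpT q) :
    IsFirstOrder (derivCoeff (coeff f)) :=
  isFirstOrder_mul_coeff isFirstOrder_deriv f

/-! ### The `L¹`-`L^p` estimate -/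

/-- Integrate `|g|^p ≤ A^{p-2} g²`. -/
lemma norm_toLp_le_interpolation {p : ℝ≥0∞} [Fact (1 ≤ p)] (hp : 2 ≤ p) (hp' : p ≠ ∞)
    {g : C(Torus, ℝ)} {A B : ℝ} (hA : ‖g‖ ≤ A) (hB : ∫ x, g x ^ 2 ≤ B) :
    ‖ContinuousMap.toLp p volume ℝ g‖ ≤ (A ^ (p.toReal - 2) * B) ^ (1 / p.toReal) := by
  have hP : 2 ≤ p.toReal := by
    have := ENNReal.toReal_mono hp' hp
    simpa using this
  have hA0 : 0 ≤ A := (norm_nonneg _).trans hA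
  have hg : MemLp g p volume := by
    have h := Lp.memLp (ContinuousMap.toLp p volume ℝ g)
    exact (memLp_congr_ae (ContinuousMap.coeFn_toLp volume g)).1 h
  rw [Lp.norm_def, eLpNorm_congr_ae (ContinuousMap.coeFn_toLp volume g),
    hg.eLpNorm_eq_integral_rpow_norm (by positivity) hp', ENNReal.toReal_ofReal (by positivity),
    one_div]
  refine Real.rpow_le_rpow (by positivity) ?_ (by positivity)
  have hint : ∀ s : ℝ, 0 ≤ s → Integrable (fun x => ‖g x‖ ^ s) (volume : Measure Torus) := fun s hs =>
    (g.continuous.norm.rpow_const fun x => Or.inr hs).integrable_of_hasCompactSupport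
      (HasCompactSupport.of_compactSpace _)
  have hint2 : Integrable (fun x => g x ^ 2) (volume : Measure Torus) :=
    (g.continuous.pow 2).integrable_of_hasCompactSupport (HasCompactSupport.of_compactSpace _)
  calc ∫ x, ‖g x‖ ^ p.toReal ≤ ∫ x, A ^ (p.toReal - 2) * g x ^ 2 := by
        refine integral_mono (hint _ (by linarith)) (hint2.const_mul _) fun x => ?_
        have h1 : ‖g x‖ ^ p.toReal = ‖g x‖ ^ (p.toReal - 2) * ‖g x‖ ^ (2 : ℝ) := by
          rw [← Real.rpow_add_of_nonneg (norm_nonneg _) (by linarith) (by norm_num)]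
          ring_nf
        simp only
        rw [h1, Real.rpow_two, Real.norm_eq_abs, sq_abs]
        refine mul_le_mul_of_nonneg_right (Real.rpow_le_rpow (abs_nonneg _) ?_ (by linarith))
          (sq_nonneg _)
        exact (g.norm_coe_le_norm x).trans hA
    _ = A ^ (p.toReal - 2) * ∫ x, g x ^ 2 := integral_const_mul _ _
    _ ≤ _ := by gcongr

lemma memLp_continuousMap (g : C(Torus, ℝ)) (q : ℝ≥0∞) [Fact (1 ≤ q)] : MemLp g q volume :=
  (memLp_congr_ae (ContinuousMap.coeFn_toLp volume g)).1
    (Lp.memLp (ContinuousMap.toLp q volume ℝ g))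

/-- `‖e^{rΔ} ∂ₓ f‖_∞ ≲ r^{-a} ‖f‖₁` for `a > 1`. -/
lemma exists_sup_heat_deriv_le (T : ℝ) {a : ℝ} (ha : 1 < a) :
    ∃ C, 0 ≤ C ∧ ∀ r ∈ Ioc 0 T, ∀ f : LpT 1,
      ‖heatSmooth r (derivCoeff (coeff f))‖ ≤ C * r ^ (-a) * ‖f‖ := by
  obtain ⟨C, hC, h⟩ := exists_heat_symbol_le T a (by linarith)
  obtain ⟨D, hD, hD'⟩ := exists_norm_coeff_le 1
  set W := ∑' k : ℤ, (1 + (k : ℝ) ^ 2) ^ (1 / 2 - a)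
  -- The derivative costs `1/2` in the exponent; summability of `(1 + k²)^{1/2 - a}` is where `a >
  -- 1` enters.
  have hs : Summable fun k : ℤ => (1 + (k : ℝ) ^ 2) ^ (1 / 2 - a) :=
    summable_one_add_sq_rpow (by linarith)
  have hW : 0 ≤ W := tsum_nonneg fun k => by positivity
  refine ⟨C * D * W, by positivity, fun r hr f => ?_⟩
  have hr0 := hr.1
  have hsum := (isFirstOrder_derivCoeff f).summable hr.1
  refine (norm_heatSmooth_le hsum).trans ?_
  have hterm : ∀ k : ℤ, Real.exp (-r * (k : ℝ) ^ 2) * ‖derivCoeff (coeff f) k‖ ≤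
      C * r ^ (-a) * (D * ‖f‖) * (1 + (k : ℝ) ^ 2) ^ (1 / 2 - a) := by
    intro k
    have h1 : ‖derivCoeff (coeff f) k‖ ≤ (1 + (k : ℝ) ^ 2) ^ (1 / 2 : ℝ) * (D * ‖f‖) := by
      rw [derivCoeff, norm_mul]
      gcongr
      · simpa using norm_intCast_le k
      · exact hD' f k
    calc _ ≤ (C * r ^ (-a) * (1 + (k : ℝ) ^ 2) ^ (-a)) *
          ((1 + (k : ℝ) ^ 2) ^ (1 / 2 : ℝ) * (D * ‖f‖)) := by
          gcongr
          exact h r hr k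
      _ = C * r ^ (-a) * (D * ‖f‖) *
          ((1 + (k : ℝ) ^ 2) ^ (1 / 2 : ℝ) * (1 + (k : ℝ) ^ 2) ^ (-a)) := by ring
      _ = _ := by rw [← Real.rpow_add (one_add_sq_pos k)]; rfl
  refine (hsum.tsum_le_tsum hterm (hs.mul_left _)).trans_eq ?_
  rw [tsum_mul_left]
  ring

/-- `‖e^{rΔ} ∂ₓ f‖₂² ≲ r^{-a} ‖f‖₁²` for `a > 3 / 2`. -/
lemma exists_sq_heat_deriv_le (T : ℝ) {a : ℝ} (ha : 3 / 2 < a) :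
    ∃ C, 0 ≤ C ∧ ∀ r ∈ Ioc 0 T, ∀ f : LpT 1,
      ∫ x, heatSmooth r (derivCoeff (coeff f)) x ^ 2 ≤ C * r ^ (-a) * ‖f‖ ^ 2 := by
  -- The symbol gets squared in Parseval's identity, hence `a / 2`; the remaining series `(1 +
  -- k²)^{1 - a}` needs `a > 3/2`.
  obtain ⟨C, hC, h⟩ := exists_heat_symbol_le T (a / 2) (by linarith)
  obtain ⟨D, hD, hD'⟩ := exists_norm_coeff_le 1
  set W := ∑' k : ℤ, (1 + (k : ℝ) ^ 2) ^ (1 - a)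
  have hs : Summable fun k : ℤ => (1 + (k : ℝ) ^ 2) ^ (1 - a) :=
    summable_one_add_sq_rpow (by linarith)
  have hW : 0 ≤ W := tsum_nonneg fun k => by positivity
  refine ⟨2 * π * (C ^ 2 * D ^ 2 * W), by positivity, fun r hr f => ?_⟩
  have hr0 := hr.1
  have hsum := (isFirstOrder_derivCoeff f).summable hr.1
  have hpars := hasSum_sq_coeff (memLp_continuousMap (heatSmooth r (derivCoeff (coeff f))) 2)
  have hterm : ∀ k : ℤ, ‖coeff (heatSmooth r (derivCoeff (coeff f))) k‖ ^ 2 ≤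
      C ^ 2 * r ^ (-a) * (D * ‖f‖) ^ 2 * (1 + (k : ℝ) ^ 2) ^ (1 - a) := by
    intro k
    have h1 : ‖derivCoeff (coeff f) k‖ ≤ (1 + (k : ℝ) ^ 2) ^ (1 / 2 : ℝ) * (D * ‖f‖) := by
      rw [derivCoeff, norm_mul]
      gcongr
      · simpa using norm_intCast_le k
      · exact hD' f k
    rw [coeff_heatSmooth hsum (derivCoeff_neg_eq_conj f), norm_mul, Complex.norm_real,
      Real.norm_eq_abs, abs_of_pos (Real.exp_pos _)]
    have hsq : ∀ {x : ℝ} (_ : 0 < x) (b : ℝ), (x ^ b) ^ 2 = x ^ (2 * b) := fun hx b => by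
      rw [← Real.rpow_natCast, ← Real.rpow_mul hx.le]; ring_nf
    calc _ ≤ ((C * r ^ (-(a / 2)) * (1 + (k : ℝ) ^ 2) ^ (-(a / 2))) *
          ((1 + (k : ℝ) ^ 2) ^ (1 / 2 : ℝ) * (D * ‖f‖))) ^ 2 := by
          gcongr
          exact h r hr k
      _ = C ^ 2 * (r ^ (-(a / 2))) ^ 2 * (D * ‖f‖) ^ 2 *
          (((1 + (k : ℝ) ^ 2) ^ (1 / 2 : ℝ)) ^ 2 * ((1 + (k : ℝ) ^ 2) ^ (-(a / 2))) ^ 2) := by ring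
      _ = _ := by
          rw [hsq hr.1, hsq (one_add_sq_pos k), hsq (one_add_sq_pos k),
            ← Real.rpow_add (one_add_sq_pos k)]
          ring_nf
  have hle := hasSum_le hterm hpars (hs.hasSum.mul_left _)
  have hpi : (0 : ℝ) < 2 * π := Real.two_pi_pos
  rw [inv_mul_le_iff₀ hpi] at hle
  refine hle.trans_eq ?_
  ring

/-- Interpolates the sup and `L²` bounds. Without the losses `ε` the exponent would be `-1 +
1/(2p)`, strictly above `-1` for finite `p`; this is what makes the Duhamel kernel integrable. -/
theorem exists_norm_heat_deriv_le (T : ℝ) (p : ℝ≥0∞) [Fact (1 ≤ p)] (hp : 2 ≤ p) (hp' : p ≠ ∞) :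
    ∃ θ : ℝ, 0 < θ ∧ ∃ C : ℝ, 0 ≤ C ∧ ∀ r ∈ Ioc 0 T, ∀ f : LpT 1,
      ‖ContinuousMap.toLp p volume ℝ (heatSmooth r (derivCoeff (coeff f)))‖ ≤
        C * r ^ (θ - 1) * ‖f‖ := by
  set P := p.toReal with hPdef
  have hP : 2 ≤ P := by
    have := ENNReal.toReal_mono hp' hp
    simpa using this
  have hP0 : 0 < P := by linarith
  -- Small enough that the total loss `ε (P - 1)` stays below the margin `1/2`.
  set ε := 1 / (4 * P) with hε
  have hε0 : 0 < ε := by positivity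
  have hεP : ε * P = 1 / 4 := by rw [hε]; field_simp
  obtain ⟨C₁, hC₁, h₁⟩ := exists_sup_heat_deriv_le T (a := 1 + ε) (by linarith)
  obtain ⟨C₂, hC₂, h₂⟩ := exists_sq_heat_deriv_le T (a := 3 / 2 + ε) (by linarith)
  refine ⟨(1 / 2 - ε * (P - 1)) / P, by
    exact div_pos (by nlinarith) hP0, (C₁ ^ (P - 2) * C₂) ^ (1 / P), by positivity, fun r hr f => ?_⟩
  have hr0 := hr.1
  refine (norm_toLp_le_interpolation hp hp' (h₁ r hr f) (h₂ r hr f)).trans_eq ?_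
  rw [← hPdef]
  have hf0 := norm_nonneg f
  have e1 : (C₁ * r ^ (-(1 + ε)) * ‖f‖) ^ (P - 2) * (C₂ * r ^ (-(3 / 2 + ε)) * ‖f‖ ^ 2) =
      (C₁ ^ (P - 2) * C₂) * r ^ (-(1 + ε) * (P - 2) + -(3 / 2 + ε)) * ‖f‖ ^ P := by
    have e2 : ‖f‖ ^ P = ‖f‖ ^ (P - 2) * ‖f‖ ^ 2 := by
      rw [← Real.rpow_two, ← Real.rpow_add_of_nonneg hf0 (by linarith) (by norm_num)]
      ring_nf
    rw [Real.mul_rpow (by positivity) hf0, Real.mul_rpow hC₁ (by positivity), ← Real.rpow_mul hr0.le,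
      Real.rpow_add hr0, e2]
    ring
  rw [e1, Real.mul_rpow (by positivity) (by positivity), Real.mul_rpow (by positivity) (by positivity),
    ← Real.rpow_mul hr0.le, ← Real.rpow_mul hf0, mul_one_div_cancel hP0.ne', Real.rpow_one]
  congr 3
  rw [mul_one_div, eq_sub_iff_add_eq, div_add_one hP0.ne']
  congr 1
  ring

/-! ### Positivity of the heat kernel -/

/-- The functional equation of the theta function (Poisson summation) turns the cosine series into a
positive multiple of a sum of Gaussians. -/
lemma cosKernel_nonneg (a : UnitAddCircle) {x : ℝ} (hx : 0 < x) : 0 ≤ HurwitzZeta.cosKernel a x := by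
  have h1 : 0 ≤ HurwitzZeta.evenKernel a (1 / x) := by
    induction a using QuotientAddGroup.induction_on with
    | H a =>
      exact HasSum.nonneg (fun n => (Real.exp_pos _).le)
        (HurwitzZeta.hasSum_int_evenKernel a (one_div_pos.2 hx))
  rw [HurwitzZeta.evenKernel_functional_equation, one_div_one_div] at h1
  exact nonneg_of_mul_nonneg_right h1 (by positivity)

/-- The heat kernel on the torus. -/
def heatKernel (t : ℝ) : C(Torus, ℝ) := heatSmooth t fun _ => 1

lemma ofReal_heatKernel {t : ℝ} (ht : 0 < t) (x : Torus) :
    ((heatKernel t x : ℝ) : ℂ) = heatSeries t (fun _ => 1) x :=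
  ofReal_heatSmooth (isFirstOrder_one.summable ht) (fun _ => by simp) x

lemma heatKernel_nonneg {t : ℝ} (ht : 0 < t) (x : Torus) : 0 ≤ heatKernel t x := by
  induction x using QuotientAddGroup.induction_on with
  | H y =>
    have hπ : (π : ℂ) ≠ 0 := by exact_mod_cast Real.pi_ne_zero
    have h1 := (hasSum_heatSeries (isFirstOrder_one.summable ht)).mapL
      (ContinuousMap.evalCLM ℂ (y : Torus))
    -- Rescaling to the circle of length `1`: position `y / (2π)` and time `t / π`, as `-π k² (t/π)
    -- = -t k²`.
    have h2 := HurwitzZeta.hasSum_int_cosKernel (y / (2 * π)) (t := t / π) (by positivity)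
    have h3 : heatSeries t (fun _ => 1) (y : Torus) =
        (HurwitzZeta.cosKernel ((y / (2 * π) : ℝ) : UnitAddCircle) (t / π) : ℂ) := by
      refine h1.unique ?_
      convert h2 using 2 with k
      have e1 : (ContinuousMap.evalCLM ℂ (y : Torus)) (fourier k) =
          Complex.exp (2 * π * Complex.I * k * y / ((2 * π : ℝ) : ℂ)) := fourier_coe_apply
      have e2 : -π * (k : ℝ) ^ 2 * (t / π) = -t * (k : ℝ) ^ 2 := by
        field_simp
      rw [map_smul, e1, e2, smul_eq_mul, mul_one, mul_comm]
      congr 2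
      push_cast
      field_simp
    have h4 := (ofReal_heatKernel ht (y : Torus)).trans h3
    have h5 : heatKernel t (y : Torus) = _ := Complex.ofReal_injective h4
    change 0 ≤ heatKernel t (y : Torus)
    rw [h5]
    exact cosKernel_nonneg _ (by positivity)

lemma coeff_zero_eq_integral (f : Torus → ℝ) :
    coeff f 0 = ((∫ x, f x ∂AddCircle.haarAddCircle : ℝ) : ℂ) := by
  rw [coeff, fourierCoeff, ← integral_complex_ofReal]
  simp

lemma integral_heatKernel {t : ℝ} (ht : 0 < t) :
    ∫ x, heatKernel t x ∂AddCircle.haarAddCircle = 1 := by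
  have h1 := coeff_heatSmooth (isFirstOrder_one.summable ht) (fun _ => by simp) 0
  rw [coeff_zero_eq_integral] at h1
  simpa [heatKernel] using h1

/-! ### Contractivity of the heat semigroup -/

/-- Translates of a continuous function. -/
def translate (f : C(Torus, ℝ)) : C(Torus, C(Torus, ℝ)) :=
  ContinuousMap.curry ⟨fun z : Torus × Torus => f (z.2 - z.1), by fun_prop⟩

lemma coeff_mul_fourier (f : C(Torus, ℝ)) (k : ℤ) (x : Torus) :
    coeff f k * fourier k x =
      ∫ y, fourier k y * (f (x - y) : ℂ) ∂(AddCircle.haarAddCircle : Measure Torus) := by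
  rw [← integral_sub_left_eq_self _ _ x, coeff, fourierCoeff, ← integral_mul_const]
  refine integral_congr_ae (Eventually.of_forall fun z => ?_)
  simp only [sub_sub_cancel, smul_eq_mul]
  have : fourier k (x - z) = fourier k x * fourier (-k) z := by
    rw [fourier_apply, fourier_apply, fourier_apply, zsmul_sub, sub_eq_add_neg,
      AddCircle.toCircle_add, neg_zsmul]
    simp
  rw [this]
  ring

/-- Pairing the kernel series with `y ↦ f (x - y)` term by term gives the heat series of `f` at `x`,
by `coeff_mul_fourier`. -/
lemma heatSmooth_coeff_apply {t : ℝ} (ht : 0 < t) (f : C(Torus, ℝ)) (x : Torus) :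
    heatSmooth t (coeff f) x =
      ∫ y, heatKernel t y * f (x - y) ∂(AddCircle.haarAddCircle : Measure Torus) := by
  let F : C(Torus, ℂ) := ⟨fun y => (f (x - y) : ℂ), by fun_prop⟩
  let Λ : C(Torus, ℂ) →L[ℂ] ℂ :=
    (coeffCont 0).comp ((ContinuousLinearMap.mul ℂ C(Torus, ℂ)).flip F)
  have hΛ : ∀ h : C(Torus, ℂ), Λ h = ∫ y, h y * F y ∂(AddCircle.haarAddCircle : Measure Torus) := by
    intro h
    change fourierCoeff (h * F : C(Torus, ℂ)) 0 = _
    simp [fourierCoeff]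
  have hf : IsFirstOrder (coeff f) := by
    have := isFirstOrder_mul_coeff isFirstOrder_one (ContinuousMap.toLp 2 volume ℝ f)
    rw [coeff_congr_ae (ContinuousMap.coeFn_toLp volume f)] at this
    simpa only [one_mul] using this
  have h1 := (hasSum_heatSeries (isFirstOrder_one.summable ht)).mapL Λ
  have h2 := (hasSum_heatSeries (hf.summable ht)).mapL (ContinuousMap.evalCLM ℂ x)
  have h3 : Λ (heatSeries t fun _ => 1) = heatSeries t (coeff f) x := by
    change _ = ContinuousMap.evalCLM ℂ x (heatSeries t (coeff f))
    refine h1.unique ?_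
    convert h2 using 2 with k
    rw [map_smul, map_smul, hΛ]
    have : (∫ y, (fourier k : C(Torus, ℂ)) y * F y ∂(AddCircle.haarAddCircle : Measure Torus)) = _ :=
      (coeff_mul_fourier f k x).symm
    rw [this]
    change _ = _ • (fourier k : C(Torus, ℂ)) x
    simp only [smul_eq_mul]
    ring
  apply Complex.ofReal_injective
  rw [ofReal_heatSmooth (hf.summable ht) (coeff_neg_eq_conj f), ← h3, hΛ, ← integral_complex_ofReal]
  refine integral_congr_ae (Eventually.of_forall fun y => ?_)
  simp only [← ofReal_heatKernel ht]
  push_cast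
  rfl

/-- The convolution as an integral with values in `C(Torus, ℝ)`, so that the inclusion into `L^p`
can be moved inside and the triangle inequality for integrals applied. -/
lemma heatSmooth_coeff_eq_integral {t : ℝ} (ht : 0 < t) (f : C(Torus, ℝ)) :
    heatSmooth t (coeff f) =
      ∫ y, heatKernel t y • translate f y ∂(AddCircle.haarAddCircle : Measure Torus) := by
  ext x
  rw [heatSmooth_coeff_apply ht, ContinuousMap.integral_apply]
  · rfl
  · exact ((heatKernel t).continuous.smul (translate f).continuous).integrable_of_hasCompactSupport
      (HasCompactSupport.of_compactSpace _)

lemma norm_toLp_translate (p : ℝ≥0∞) [Fact (1 ≤ p)] (f : C(Torus, ℝ)) (y : Torus) :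
    ‖ContinuousMap.toLp p volume ℝ (translate f y)‖ = ‖ContinuousMap.toLp p volume ℝ f‖ := by
  rw [Lp.norm_def, Lp.norm_def, eLpNorm_congr_ae (ContinuousMap.coeFn_toLp volume _),
    eLpNorm_congr_ae (ContinuousMap.coeFn_toLp volume f)]
  congr 1
  exact eLpNorm_comp_measurePreserving f.continuous.aestronglyMeasurable
    (measurePreserving_sub_right volume y)

/-- An average of translates, with nonnegative weights of mass one, of a function whose `L^p` norm
is translation invariant. -/
lemma norm_toLp_heatSmooth_le (p : ℝ≥0∞) [Fact (1 ≤ p)] {t : ℝ} (ht : 0 < t) (f : C(Torus, ℝ)) :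
    ‖ContinuousMap.toLp p volume ℝ (heatSmooth t (coeff f))‖ ≤
      ‖ContinuousMap.toLp p volume ℝ f‖ := by
  have hint : Integrable (fun y => heatKernel t y • translate f y)
      (AddCircle.haarAddCircle : Measure Torus) :=
    ((heatKernel t).continuous.smul (translate f).continuous).integrable_of_hasCompactSupport
      (HasCompactSupport.of_compactSpace _)
  rw [heatSmooth_coeff_eq_integral ht, ← ContinuousLinearMap.integral_comp_comm _ hint]
  refine (norm_integral_le_integral_norm _).trans_eq ?_
  simp only [map_smul, norm_smul, norm_toLp_translate, Real.norm_eq_abs,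
    abs_of_nonneg (heatKernel_nonneg ht _)]
  rw [integral_mul_const, integral_heatKernel ht, one_mul]

/-- The heat semigroup as a continuous linear map, for positive times. -/
def heatCLM (p : ℝ≥0∞) [Fact (1 ≤ p)] (t : ℝ) : LpT p →L[ℝ] LpT p :=
  (ContinuousMap.toLp p volume ℝ).comp (smoothing p (fun _ => 1) t)

lemma heatCLM_apply (p : ℝ≥0∞) [Fact (1 ≤ p)] {t : ℝ} (ht : 0 < t) (f : LpT p) :
    heatCLM p t f = heat p t f := by
  rw [heat, if_neg (not_le.2 ht), heatCLM, ContinuousLinearMap.comp_apply,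
    smoothing_apply isFirstOrder_one ht]
  simp only [one_mul]

lemma norm_heatCLM_apply_le {p : ℝ≥0∞} [Fact (1 ≤ p)] (hp : p ≠ ∞) {t : ℝ} (ht : 0 < t) (f : LpT p) :
    ‖heatCLM p t f‖ ≤ ‖f‖ := by
  have hd := ContinuousMap.toLp_denseRange ℝ (volume : Measure Torus) ℝ hp
  refine hd.induction_on (p := fun f => ‖heatCLM p t f‖ ≤ ‖f‖) f
    (isClosed_le (by fun_prop) continuous_norm) fun g => ?_
  rw [heatCLM_apply p ht, heat, if_neg (not_le.2 ht),
    coeff_congr_ae (ContinuousMap.coeFn_toLp volume g)]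
  exact norm_toLp_heatSmooth_le p ht g

lemma continuousOn_heatCLM (p : ℝ≥0∞) [Fact (1 ≤ p)] : ContinuousOn (heatCLM p) (Ioi 0) :=
  continuousOn_const.clm_comp (continuousOn_smoothing isFirstOrder_one)

/-! ### Strong continuity of the heat semigroup -/

/-- The coefficient of `re G` is the mean of `Ĝ(k)` and the conjugate of `Ĝ(-k)`. -/
lemma norm_coeff_reMap_le (G : C(Torus, ℂ)) (k : ℤ) :
    ‖coeff (reMap G) k‖ ≤ ‖fourierCoeff G k‖ + ‖fourierCoeff G (-k)‖ := by
  have hi : Integrable G AddCircle.haarAddCircle :=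
    G.continuous.integrable_of_hasCompactSupport (HasCompactSupport.of_compactSpace _)
  have hc : ∫ x, fourier (-k) x * (starRingEnd ℂ) (G x) ∂(AddCircle.haarAddCircle : Measure Torus) =
      (starRingEnd ℂ) (fourierCoeff G (-k)) := by
    rw [fourierCoeff, ← integral_conj]
    refine integral_congr_ae (Eventually.of_forall fun x => ?_)
    simp only [smul_eq_mul, map_mul, fourier_neg, Complex.conj_conj]
  have h1 : coeff (reMap G) k =
      (fourierCoeff G k + (starRingEnd ℂ) (fourierCoeff G (-k))) / 2 := by
    rw [← hc, coeff, fourierCoeff, fourierCoeff, ← integral_add, ← integral_div]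
    · refine integral_congr_ae (Eventually.of_forall fun x => ?_)
      simp only [reMap_apply, Complex.re_eq_add_conj, smul_eq_mul]
      ring
    · exact hi.fourier_smul _
    · refine Continuous.integrable_of_hasCompactSupport ?_ (HasCompactSupport.of_compactSpace _)
      exact (fourier (-k)).continuous.mul (Complex.continuous_conj.comp G.continuous)
  rw [h1, norm_div]
  have h2 := norm_add_le (fourierCoeff G k) ((starRingEnd ℂ) (fourierCoeff G (-k)))
  rw [RCLike.norm_conj] at h2
  have h3 : ‖(2 : ℂ)‖ = 2 := by simp
  rw [h3]
  linarith [norm_nonneg (fourierCoeff G k), norm_nonneg (fourierCoeff G (-k))]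

/-- Real parts of trigonometric polynomials are dense, and their coefficients are summable. -/
lemma dense_summable_coeff : Dense {g : C(Torus, ℝ) | Summable fun k => ‖coeff g k‖} := by
  intro g
  let G : C(Torus, ℂ) := ⟨fun x => (g x : ℂ), by fun_prop⟩
  have hG : G ∈ closure (Submodule.span ℂ (range <| @fourier (2 * π)) : Set C(Torus, ℂ)) := by
    rw [← Submodule.topologicalClosure_coe, span_fourier_closure_eq_top]
    trivial
  have hg : reMap G = g := by ext x; simp [G]
  rw [← hg]
  refine map_mem_closure reMap.continuous hG fun H hH => ?_
  have hsum : Summable fun k => ‖fourierCoeff H k‖ := by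
    refine Submodule.span_induction (p := fun (H : C(Torus, ℂ)) _ => Summable fun k => ‖fourierCoeff H k‖)
      ?_ ?_ ?_ ?_ hH
    · rintro _ ⟨n, rfl⟩
      simp only [fourierCoeff_fourier]
      refine summable_of_ne_finset_zero (s := {n}) fun k hk => ?_
      have : n ≠ k := fun h => hk (by simp [h])
      simp [this]
    · simp [fourierCoeff]
    · intro H₁ H₂ _ _ h₁ h₂
      refine Summable.of_nonneg_of_le (fun k => norm_nonneg _) (fun k => ?_) (h₁.add h₂)
      have := map_add (coeffCont k) H₁ H₂
      simp only [coeffCont_apply] at this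
      rw [this]
      exact norm_add_le _ _
    · intro c H _ h
      have : ∀ k, fourierCoeff (c • H : C(Torus, ℂ)) k = c * fourierCoeff H k := fun k =>
        map_smul (coeffCont k) c H
      simp only [this, norm_mul]
      exact h.mul_left _
  exact Summable.of_nonneg_of_le (fun k => norm_nonneg _) (norm_coeff_reMap_le H)
    (hsum.add ((Equiv.neg ℤ).summable_iff.2 hsum))

lemma tendsto_heatSmooth_coeff {g : C(Torus, ℝ)} (hg : Summable fun k => ‖coeff g k‖) :
    Tendsto (fun t => heatSmooth t (coeff g)) (𝓝[≥] 0) (𝓝 g) := by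
  let G : C(Torus, ℂ) := ⟨fun x => (g x : ℂ), by fun_prop⟩
  have hG : HasSum (fun k => coeff g k • (fourier k : C(Torus, ℂ))) G :=
    hasSum_fourier_series_of_summable (f := G) (Summable.of_norm hg)
  have h0 : heatSeries 0 (coeff g) = G := by
    rw [← hG.tsum_eq, heatSeries]
    simp
  have hc : ContinuousOn (fun t => heatSeries t (coeff g)) (Ici 0) := by
    refine continuousOn_tsum (fun k => by fun_prop) hg ?_
    intro k t ht
    rw [norm_heat_term]
    refine mul_le_of_le_one_left (norm_nonneg _) (Real.exp_le_one_iff.2 ?_)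
    have : 0 ≤ t * (k : ℝ) ^ 2 := mul_nonneg ht (sq_nonneg _)
    linarith
  have h1 : Tendsto (fun t => reMap (heatSeries t (coeff g))) (𝓝[≥] 0)
      (𝓝 (reMap (heatSeries 0 (coeff g)))) :=
    (reMap.continuous.tendsto _).comp (hc 0 (mem_Ici.2 le_rfl))
  have hg' : reMap G = g := by ext x; simp [G]
  rwa [h0, hg'] at h1

/-- Convergence holds on the dense class with summable coefficients and extends to `L^p` because the
operators are uniformly contractive. -/
lemma tendsto_heatCLM {p : ℝ≥0∞} [Fact (1 ≤ p)] (hp : p ≠ ∞) (f : LpT p) :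
    Tendsto (fun t => heatCLM p t f) (𝓝[>] 0) (𝓝 f) := by
  have hdense : DenseRange fun g : {g : C(Torus, ℝ) | Summable fun k => ‖coeff g k‖} =>
      ContinuousMap.toLp p volume ℝ (g : C(Torus, ℝ)) :=
    (ContinuousMap.toLp_denseRange ℝ (volume : Measure Torus) ℝ hp).comp
      dense_summable_coeff.denseRange_val (ContinuousLinearMap.continuous _)
  rw [Metric.tendsto_nhds]
  intro ε hε
  obtain ⟨⟨g, hg⟩, hfg⟩ := hdense.exists_dist_lt f (show 0 < ε / 3 by positivity)
  set h : LpT p := ContinuousMap.toLp p volume ℝ g with hh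
  have h1 : Tendsto (fun t => heatCLM p t h) (𝓝[>] 0) (𝓝 h) := by
    have h2 : Tendsto (fun t => ContinuousMap.toLp p volume ℝ (heatSmooth t (coeff g))) (𝓝[>] 0)
        (𝓝 h) :=
      ((ContinuousLinearMap.continuous _).tendsto g).comp
        ((tendsto_heatSmooth_coeff hg).mono_left (nhdsWithin_mono _ Ioi_subset_Ici_self))
    refine h2.congr' ?_
    filter_upwards [self_mem_nhdsWithin] with t ht
    rw [heatCLM_apply p ht, heat, if_neg (not_le.2 ht),
      coeff_congr_ae (ContinuousMap.coeFn_toLp volume g)]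
  filter_upwards [Metric.tendsto_nhds.1 h1 (ε / 3) (by positivity), self_mem_nhdsWithin] with t h3 ht
  have h4 : dist (heatCLM p t f) (heatCLM p t h) ≤ dist f h := by
    rw [dist_eq_norm, dist_eq_norm, ← map_sub]
    exact norm_heatCLM_apply_le hp ht _
  have h5 : dist f h < ε / 3 := hfg
  have h6 := dist_triangle4 (heatCLM p t f) (heatCLM p t h) h f
  rw [dist_comm h f] at h6
  linarith

theorem continuousOn_heat {p : ℝ≥0∞} [Fact (1 ≤ p)] (hp : p ≠ ∞) (f : LpT p) :
    ContinuousOn (fun t => heat p t f) (Ici 0) := by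
  intro t ht
  rcases (mem_Ici.1 ht).eq_or_lt with rfl | ht
  · have h0 : heat p 0 f = f := by simp [heat]
    have h1 : Tendsto (fun t => heat p t f) (𝓝[>] 0) (𝓝 (heat p 0 f)) := by
      rw [h0]
      refine (tendsto_heatCLM hp f).congr' ?_
      filter_upwards [self_mem_nhdsWithin] with t ht
      exact heatCLM_apply p ht f
    rw [← continuousWithinAt_Ioi_iff_Ici]
    exact h1
  · have h1 : ContinuousAt (fun t => heatCLM p t f) t :=
      ((continuousOn_heatCLM p).clm_apply continuousOn_const).continuousAt (Ioi_mem_nhds ht)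
    refine (h1.congr ?_).continuousWithinAt
    filter_upwards [Ioi_mem_nhds ht] with s hs
    exact heatCLM_apply p hs f

/-! ### Continuity of Sobolev paths in `L²` -/

lemma enorm_sq_eq_ofReal (z : ℂ) : ‖z‖ₑ ^ 2 = ENNReal.ofReal (‖z‖ ^ 2) := by
  rw [ENNReal.ofReal_pow (norm_nonneg _), ofReal_norm]

lemma norm_sq_eq_integral (u : LpT 2) : ‖u‖ ^ 2 = ∫ x, u x ^ 2 := by
  have h := @L2.inner_def Torus ℝ ℝ _ _ _ _ _ u u
  rw [real_inner_self_eq_norm_sq] at h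
  rw [h]
  refine integral_congr_ae (Eventually.of_forall fun x => ?_)
  simp [sq]

lemma hasSum_sq_coeff_norm (u : LpT 2) :
    HasSum (fun k => ‖coeff u k‖ ^ 2) ((2 * π)⁻¹ * ‖u‖ ^ 2) := by
  rw [norm_sq_eq_integral]
  exact hasSum_sq_coeff (Lp.memLp u)

lemma ofReal_norm_sq_le_sobolevNormSq {s : ℝ} (hs : 0 ≤ s) (u : LpT 2) :
    ENNReal.ofReal ((2 * π)⁻¹ * ‖u‖ ^ 2) ≤ sobolevNormSq s u := by
  have h := hasSum_sq_coeff_norm u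
  rw [← h.tsum_eq, ENNReal.ofReal_tsum_of_nonneg (fun k => by positivity) h.summable]
  refine ENNReal.tsum_le_tsum fun k => ?_
  rw [enorm_sq_eq_ofReal]
  refine le_mul_of_one_le_left (by positivity) ?_
  rw [ENNReal.one_le_ofReal]
  exact Real.one_le_rpow (one_le_one_add_sq k) hs

/-- For `s ≥ 0` the weights are at least `1`, so by Parseval the `H^s` norm controls the `L²` norm.
-/
lemma IsContinuousSobolevPath.continuousOn {T s : ℝ} (hs : 0 ≤ s) {v : ℝ → LpT 2}
    (hv : IsContinuousSobolevPath T s v) : ContinuousOn v (Icc 0 T) := by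
  intro t ht
  have h1 := (hv t ht).2
  have h2 : Tendsto (fun r => ENNReal.ofReal ((2 * π)⁻¹ * ‖v r - v t‖ ^ 2)) (𝓝[Icc 0 T] t) (𝓝 0) :=
    tendsto_of_tendsto_of_tendsto_of_le_of_le tendsto_const_nhds h1 (fun _ => zero_le)
      fun r => ofReal_norm_sq_le_sobolevNormSq hs _
  have h3 := (ENNReal.tendsto_toReal ENNReal.zero_ne_top).comp h2
  have h4 : Tendsto (fun r => √(2 * π * ((2 * π)⁻¹ * ‖v r - v t‖ ^ 2))) (𝓝[Icc 0 T] t) (𝓝 0) := by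
    have h5 : Tendsto (fun r => (2 * π)⁻¹ * ‖v r - v t‖ ^ 2) (𝓝[Icc 0 T] t) (𝓝 0) := by
      refine h3.congr fun r => ?_
      exact ENNReal.toReal_ofReal (by positivity)
    have h6 := (Real.continuous_sqrt.tendsto _).comp (h5.const_mul (2 * π))
    simpa [Function.comp_def] using h6
  rw [ContinuousWithinAt, tendsto_iff_norm_sub_tendsto_zero]
  refine h4.congr fun r => ?_
  rw [← mul_assoc, mul_inv_cancel₀ Real.two_pi_pos.ne', one_mul, Real.sqrt_sq (norm_nonneg _)]

/-! ### The nonlinearity -/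

/-- The product `L² × L² → L¹`. -/
def mulL : LpT 2 →L[ℝ] LpT 2 →L[ℝ] LpT 1 :=
  (ContinuousLinearMap.mul ℝ ℝ).holderL volume 2 2 1

lemma coeFn_mulL (f g : LpT 2) : mulL f g =ᵐ[volume] fun x => f x * g x :=
  ContinuousLinearMap.coeFn_holder (ContinuousLinearMap.mul ℝ ℝ) f g

/-- The nonlinearity `w ↦ (w + v)²`, from `L^p` to `L¹`. -/
def nonlinearity {p : ℝ≥0∞} [Fact (1 ≤ p)] (hp : 2 ≤ p) (v : LpT 2) (w : LpT p) : LpT 1 :=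
  mulL (lpInclusion hp w + v) (lpInclusion hp w + v)

lemma coeFn_add_inclusion {p : ℝ≥0∞} [Fact (1 ≤ p)] (hp : 2 ≤ p) (v : LpT 2) (w : LpT p) :
    (lpInclusion hp w + v : LpT 2) =ᵐ[volume] fun x => w x + v x := by
  filter_upwards [Lp.coeFn_add (lpInclusion hp w) v, coeFn_lpInclusion hp w] with x h1 h2
  rw [h1, Pi.add_apply, h2]

lemma coeff_nonlinearity {p : ℝ≥0∞} [Fact (1 ≤ p)] (hp : 2 ≤ p) (v : LpT 2) (w : LpT p) :
    coeff (nonlinearity hp v w) = coeff fun x => (w x + v x) ^ 2 := by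
  refine coeff_congr_ae ?_
  filter_upwards [coeFn_mulL (lpInclusion hp w + v) (lpInclusion hp w + v),
    coeFn_add_inclusion hp v w] with x h1 h2
  rw [nonlinearity, h1, h2, sq]

lemma continuousOn_nonlinearity {p : ℝ≥0∞} [Fact (1 ≤ p)] (hp : 2 ≤ p) {v : ℝ → LpT 2}
    {w : ℝ → LpT p} {s : Set ℝ} (hv : ContinuousOn v s) (hw : ContinuousOn w s) :
    ContinuousOn (fun t => nonlinearity hp (v t) (w t)) s := by
  have h : ContinuousOn (fun t => lpInclusion hp (w t) + v t) s :=
    ((lpInclusion hp).continuous.comp_continuousOn hw).add hv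
  exact (mulL.continuous.comp_continuousOn h).clm_apply h

lemma exists_lipschitz_nonlinearity {p : ℝ≥0∞} [Fact (1 ≤ p)] (hp : 2 ≤ p) {T : ℝ} {v : ℝ → LpT 2}
    (hv : ContinuousOn v (Icc 0 T)) (R : ℝ) :
    ∃ L, ∀ s ∈ Icc 0 T, ∀ x y : LpT p, ‖x‖ ≤ R → ‖y‖ ≤ R →
      ‖nonlinearity hp (v s) x - nonlinearity hp (v s) y‖ ≤ L * ‖x - y‖ := by
  obtain ⟨V, hV⟩ := isCompact_Icc.exists_bound_of_continuousOn hv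
  set ι : LpT p →L[ℝ] LpT 2 := lpInclusion hp
  refine ⟨2 * (‖mulL‖ * (‖ι‖ * R + V) * ‖ι‖), fun s hs x y hx hy => ?_⟩
  have hb : ∀ z : LpT p, ‖z‖ ≤ R → ‖ι z + v s‖ ≤ ‖ι‖ * R + V := fun z hz =>
    (norm_add_le _ _).trans (add_le_add ((ι.le_opNorm z).trans (by gcongr)) (hV s hs))
  -- With `X` and `Y` the two shifted functions, this is `X² - Y² = X (X - Y) + (X - Y) Y`.
  have h1 : nonlinearity hp (v s) x - nonlinearity hp (v s) y =
      mulL (ι x + v s) (ι (x - y)) + mulL (ι (x - y)) (ι y + v s) := by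
    simp only [nonlinearity, map_sub, map_add, add_apply,
      sub_apply, ι]
    abel
  have h2 : ‖ι (x - y)‖ ≤ ‖ι‖ * ‖x - y‖ := ι.le_opNorm _
  have h0 : 0 ≤ ‖ι‖ * R + V := (norm_nonneg _).trans (hb x hx)
  rw [h1]
  calc _ ≤ ‖mulL‖ * ‖ι x + v s‖ * ‖ι (x - y)‖ + ‖mulL‖ * ‖ι (x - y)‖ * ‖ι y + v s‖ :=
        (norm_add_le _ _).trans (add_le_add (mulL.le_opNorm₂ _ _) (mulL.le_opNorm₂ _ _))
    _ ≤ ‖mulL‖ * (‖ι‖ * R + V) * (‖ι‖ * ‖x - y‖) + ‖mulL‖ * (‖ι‖ * ‖x - y‖) * (‖ι‖ * R + V) := by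
        gcongr
        · exact hb x hx
        · exact hb y hy
    _ = _ := by ring

/-! ### Mild solutions -/

/-- The operator `e^{rΔ} ∂ₓ` from `L¹` to `L^p`, for `r > 0`. -/
def heatDerivCLM (p : ℝ≥0∞) [Fact (1 ≤ p)] (r : ℝ) : LpT 1 →L[ℝ] LpT p :=
  (ContinuousMap.toLp p volume ℝ).comp (smoothing 1 (fun k => Complex.I * k) r)

lemma heatDerivCLM_apply (p : ℝ≥0∞) [Fact (1 ≤ p)] {r : ℝ} (hr : 0 < r) (f : LpT 1) :
    heatDerivCLM p r f = ContinuousMap.toLp p volume ℝ (heatSmooth r (derivCoeff (coeff f))) := by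
  rw [heatDerivCLM, ContinuousLinearMap.comp_apply, smoothing_apply isFirstOrder_deriv hr]
  rfl

lemma continuousOn_heatDerivCLM (p : ℝ≥0∞) [Fact (1 ≤ p)] :
    ContinuousOn (heatDerivCLM p) (Ioi 0) :=
  continuousOn_const.clm_comp (continuousOn_smoothing isFirstOrder_deriv)

lemma exists_norm_heatDerivCLM_le (T : ℝ) {p : ℝ≥0∞} [Fact (1 ≤ p)] (hp : 2 ≤ p) (hp' : p ≠ ∞) :
    ∃ θ : ℝ, 0 < θ ∧ ∃ C : ℝ, 0 ≤ C ∧ ∀ r ∈ Ioc 0 T, ‖heatDerivCLM p r‖ ≤ C * r ^ (θ - 1) := by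
  obtain ⟨θ, hθ, C, hC, h⟩ := exists_norm_heat_deriv_le T p hp hp'
  refine ⟨θ, hθ, C, hC, fun r hr => ?_⟩
  have hr0 := hr.1
  refine ContinuousLinearMap.opNorm_le_bound _ (by positivity) fun f => ?_
  rw [heatDerivCLM_apply p hr.1]
  exact h r hr f

lemma duhamelTerm_eq {p : ℝ≥0∞} [Fact (1 ≤ p)] (hp : 2 ≤ p) {r : ℝ} (hr : 0 < r) (w : LpT p)
    (v : LpT 2) : duhamelTerm p r w v = heatDerivCLM p r (nonlinearity hp v w) := by
  rw [heatDerivCLM_apply p hr, coeff_nonlinearity hp, duhamelTerm]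

lemma integral_duhamelTerm {p : ℝ≥0∞} [Fact (1 ≤ p)] (hp : 2 ≤ p) {t : ℝ} (ht : 0 ≤ t)
    (w : ℝ → LpT p) (v : ℝ → LpT 2) :
    ∫ s in (0 : ℝ)..t, duhamelTerm p (t - s) (w s) (v s) =
      ∫ s in (0 : ℝ)..t, heatDerivCLM p (t - s) (nonlinearity hp (v s) (w s)) := by
  rw [intervalIntegral.integral_of_le ht, intervalIntegral.integral_of_le ht,
    integral_Ioc_eq_integral_Ioo, integral_Ioc_eq_integral_Ioo]
  exact setIntegral_congr_fun measurableSet_Ioo fun s hs => duhamelTerm_eq hp (sub_pos.2 hs.2) _ _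

/-- The two integrands agree for `0 < s < t`, which is almost everywhere, and the integrability
clause follows from the bound `C r^{θ-1}` once `w` is continuous. -/
lemma isMildSolution_iff {p : ℝ≥0∞} [Fact (1 ≤ p)] (hp : 2 ≤ p) (hp' : p ≠ ∞) {T : ℝ}
    {v : ℝ → LpT 2} (hv : ContinuousOn v (Icc 0 T)) {w₀ : LpT p} {w : ℝ → LpT p} :
    IsMildSolution p T v w₀ w ↔
      IsAbstractMild (heatDerivCLM p) (fun s => nonlinearity hp (v s)) (fun t => heat p t w₀) T w := by
  refine and_congr_right fun hw => forall₂_congr fun t ht => ?_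
  rw [integral_duhamelTerm hp ht.1, and_iff_right]
  obtain ⟨θ, hθ, C, -, h⟩ := exists_norm_heatDerivCLM_le T hp hp'
  have hi := intervalIntegrable_convolution (continuousOn_heatDerivCLM p) hθ h
    (continuousOn_nonlinearity hp hv hw) ht
  rw [intervalIntegrable_iff_integrableOn_Ioo_of_le ht.1] at hi ⊢
  exact hi.congr_fun (fun s hs => (duhamelTerm_eq hp (sub_pos.2 hs.2) _ _).symm) measurableSet_Ioo

theorem exists_unique_isMildSolution {T : ℝ} (hT : 0 < T) {p : ℝ≥0∞} [Fact (1 ≤ p)] (hp : 2 ≤ p)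
    (hp' : p ≠ ∞) {v : ℝ → LpT 2} (hv : ContinuousOn v (Icc 0 T)) (w₀ : LpT p) :
    ∃ T', 0 < T' ∧ T' ≤ T ∧ ∃ w, IsMildSolution p T' v w₀ w ∧
      ∀ w', IsMildSolution p T' v w₀ w' → EqOn w' w (Icc 0 T') := by
  obtain ⟨θ, hθ, C, hC, hS⟩ := exists_norm_heatDerivCLM_le T hp hp'
  have hsub : ∀ {T'}, T' ≤ T → Icc 0 T' ⊆ Icc 0 T := fun h => Icc_subset_Icc_right h
  have hN : ∀ T' ≤ T, ∀ w : ℝ → LpT p, ContinuousOn w (Icc 0 T') →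
      ContinuousOn (fun s => nonlinearity hp (v s) (w s)) (Icc 0 T') := fun T' hT' w hw =>
    continuousOn_nonlinearity hp (hv.mono (hsub hT')) hw
  obtain ⟨T', hT'0, hT'T, w, hw⟩ := exists_isAbstractMild (continuousOn_heatDerivCLM p) hT hθ hC hS
    hN (exists_lipschitz_nonlinearity hp hv)
    ((continuousOn_heat hp' w₀).mono Icc_subset_Ici_self)
  have hv' := hv.mono (hsub hT'T)
  refine ⟨T', hT'0, hT'T, w, (isMildSolution_iff hp hp' hv').2 hw, fun w' hw' => ?_⟩
  exact IsAbstractMild.eqOn (continuousOn_heatDerivCLM p) hT'0.le hθ hC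
    (fun r hr => hS r ⟨hr.1, hr.2.trans hT'T⟩) (hN T' hT'T)
    (exists_lipschitz_nonlinearity hp hv') hw ((isMildSolution_iff hp hp' hv').1 hw')

/-! ### Products in Sobolev spaces -/

lemma ennreal_cauchySchwarz {ι : Type*} (a b : ι → ℝ≥0∞) :
    (∑' i, a i * b i) ^ 2 ≤ (∑' i, a i ^ 2) * ∑' i, b i ^ 2 := by
  let _ : MeasurableSpace ι := ⊤
  have h := ENNReal.lintegral_mul_le_Lp_mul_Lq (Measure.count : Measure ι)
    Real.HolderConjugate.two_two (f := a) (g := b) measurable_from_top.aemeasurable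
    measurable_from_top.aemeasurable
  simp only [lintegral_count, Pi.mul_apply, ENNReal.rpow_two] at h
  calc _ ≤ ((∑' i, a i ^ 2) ^ (1 / 2 : ℝ) * (∑' i, b i ^ 2) ^ (1 / 2 : ℝ)) ^ 2 := by gcongr
    _ = _ := by
      rw [← ENNReal.mul_rpow_of_nonneg _ _ (by norm_num), ← ENNReal.rpow_two, ← ENNReal.rpow_mul]
      norm_num

/-- The weight `(1 + k²)^s`. -/
def weight (s : ℝ) (k : ℤ) : ℝ≥0∞ := ENNReal.ofReal ((1 + (k : ℝ) ^ 2) ^ s)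

lemma weight_mul_weight (s r : ℝ) (k : ℤ) : weight s k * weight r k = weight (s + r) k := by
  rw [weight, weight, weight, ← ENNReal.ofReal_mul (by positivity), Real.rpow_add (one_add_sq_pos k)]

@[simp] lemma weight_zero (k : ℤ) : weight 0 k = 1 := by simp [weight]

lemma weight_sq (s : ℝ) (k : ℤ) : weight s k ^ 2 = weight (2 * s) k := by
  rw [sq, weight_mul_weight, two_mul]

/-- `∑ₖ (1 + k²)^s |a k|²`. -/
def weightedSum (s : ℝ) (a : ℤ → ℂ) : ℝ≥0∞ := ∑' k : ℤ, weight s k * ‖a k‖ₑ ^ 2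

lemma sobolevNormSq_eq (s : ℝ) (f : Torus → ℝ) : sobolevNormSq s f = weightedSum s (coeff f) := rfl

lemma weightedSum_add_le (s : ℝ) (a b : ℤ → ℂ) :
    weightedSum s (fun k => a k + b k) ≤ 2 * (weightedSum s a + weightedSum s b) := by
  rw [weightedSum, weightedSum, weightedSum, ← ENNReal.tsum_add, ← ENNReal.tsum_mul_left]
  refine ENNReal.tsum_le_tsum fun k => ?_
  have h : ‖a k + b k‖ₑ ^ 2 ≤ 2 * (‖a k‖ₑ ^ 2 + ‖b k‖ₑ ^ 2) := by
    rw [enorm_sq_eq_ofReal, enorm_sq_eq_ofReal, enorm_sq_eq_ofReal,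
      ← ENNReal.ofReal_add (by positivity) (by positivity),
      ← ENNReal.ofReal_ofNat 2, ← ENNReal.ofReal_mul (by norm_num)]
    refine ENNReal.ofReal_le_ofReal ?_
    have h1 := norm_add_le (a k) (b k)
    nlinarith [sq_nonneg (‖a k‖ - ‖b k‖), norm_nonneg (a k + b k)]
  calc _ ≤ weight s k * (2 * (‖a k‖ₑ ^ 2 + ‖b k‖ₑ ^ 2)) := by gcongr
    _ = _ := by ring

lemma weightedSum_lt_top_of_summable {s : ℝ} {a : ℤ → ℂ}
    (h : Summable fun k : ℤ => (1 + (k : ℝ) ^ 2) ^ s * ‖a k‖ ^ 2) : weightedSum s a < ∞ := by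
  have : weightedSum s a = ENNReal.ofReal (∑' k : ℤ, (1 + (k : ℝ) ^ 2) ^ s * ‖a k‖ ^ 2) := by
    rw [ENNReal.ofReal_tsum_of_nonneg (fun k => by positivity) h, weightedSum]
    refine tsum_congr fun k => ?_
    rw [ENNReal.ofReal_mul (by positivity), weight, enorm_sq_eq_ofReal]
  rw [this]
  exact ENNReal.ofReal_lt_top

/-- Since `1 + k² ≤ 4 max x y` and `x^σ, y^σ ≥ 1`, the left weight is at most `4^σ · 2 x^σ y^σ`. The
inequality between geometric and arithmetic means then separates `j` from `k - j`, leaving two sums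
that do not depend on `k`. This is not sharp, but any positive `σ` suffices for the theorem. -/
lemma rpow_weight_convolution_le {σ α : ℝ} (hσ : 0 ≤ σ) (k j : ℤ) :
    (1 + (k : ℝ) ^ 2) ^ σ * ((1 + (j : ℝ) ^ 2) ^ (-α) * (1 + ((k - j : ℤ) : ℝ) ^ 2) ^ (-α)) ≤
      2 * 4 ^ σ * ((1 + (j : ℝ) ^ 2) ^ (2 * (σ - α)) + (1 + ((k - j : ℤ) : ℝ) ^ 2) ^ (2 * (σ - α))) := by
  have hx1 := one_le_one_add_sq j
  have hy1 := one_le_one_add_sq (k - j)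
  have hk : 1 + (k : ℝ) ^ 2 ≤ 2 * (1 + (j : ℝ) ^ 2) + 2 * (1 + ((k - j : ℤ) : ℝ) ^ 2) := by
    push_cast
    nlinarith [sq_nonneg ((j : ℝ) - (k - j))]
  set x : ℝ := 1 + (j : ℝ) ^ 2
  set y : ℝ := 1 + ((k - j : ℤ) : ℝ) ^ 2
  have hx : 0 < x := by linarith
  have hy : 0 < y := by linarith
  have hxs : 1 ≤ x ^ σ := Real.one_le_rpow hx1 hσ
  have hys : 1 ≤ y ^ σ := Real.one_le_rpow hy1 hσ
  have hks : (1 + (k : ℝ) ^ 2) ^ σ ≤ 4 ^ σ * (2 * (x ^ σ * y ^ σ)) := by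
    have h4 : (0 : ℝ) ≤ 4 ^ σ := by positivity
    rcases le_total x y with hxy | hxy
    · calc (1 + (k : ℝ) ^ 2) ^ σ ≤ (4 * y) ^ σ :=
            Real.rpow_le_rpow (one_add_sq_pos k).le (by linarith) hσ
        _ = 4 ^ σ * (1 * y ^ σ) := by rw [Real.mul_rpow (by norm_num) hy.le, one_mul]
        _ ≤ _ := mul_le_mul_of_nonneg_left (by nlinarith) h4
    · calc (1 + (k : ℝ) ^ 2) ^ σ ≤ (4 * x) ^ σ :=
            Real.rpow_le_rpow (one_add_sq_pos k).le (by linarith) hσ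
        _ = 4 ^ σ * (x ^ σ * 1) := by rw [Real.mul_rpow (by norm_num) hx.le, mul_one]
        _ ≤ _ := mul_le_mul_of_nonneg_left (by nlinarith) h4
  have e : ∀ {z : ℝ} (_ : 0 < z), z ^ (2 * (σ - α)) = (z ^ σ * z ^ (-α)) ^ 2 := fun hz => by
    rw [← Real.rpow_add hz, ← Real.rpow_natCast, ← Real.rpow_mul hz.le]
    ring_nf
  rw [e hx, e hy]
  calc _ ≤ 4 ^ σ * (2 * (x ^ σ * y ^ σ)) * (x ^ (-α) * y ^ (-α)) := by gcongr
    _ = 2 * 4 ^ σ * ((x ^ σ * x ^ (-α)) * (y ^ σ * y ^ (-α))) := by ring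
    _ ≤ _ := by
      gcongr
      nlinarith [sq_nonneg (x ^ σ * x ^ (-α) - y ^ σ * y ^ (-α)), sq_nonneg (x ^ σ * x ^ (-α)),
        sq_nonneg (y ^ σ * y ^ (-α))]

lemma exists_weight_convolution_le {σ α : ℝ} (hσ : 0 ≤ σ) (h : 2 * (σ - α) < -(1 / 2)) :
    ∃ C, C < ∞ ∧ ∀ k : ℤ, weight σ k * ∑' j : ℤ, weight (-α) j * weight (-α) (k - j) ≤ C := by
  set Z : ℝ≥0∞ := ∑' j : ℤ, weight (2 * (σ - α)) j with hZ
  have hZt : Z < ∞ := by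
    have hs := summable_one_add_sq_rpow h
    rw [hZ]
    simp only [weight]
    rw [← ENNReal.ofReal_tsum_of_nonneg (fun k => by positivity) hs]
    exact ENNReal.ofReal_lt_top
  refine ⟨ENNReal.ofReal (2 * 4 ^ σ) * (Z + Z), ENNReal.mul_lt_top ENNReal.ofReal_lt_top
    (ENNReal.add_lt_top.2 ⟨hZt, hZt⟩), fun k => ?_⟩
  have hshift : ∑' j : ℤ, weight (2 * (σ - α)) (k - j) = Z :=
    (Equiv.subLeft k).tsum_eq fun j => weight (2 * (σ - α)) j
  rw [← ENNReal.tsum_mul_left]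
  calc _ ≤ ∑' j : ℤ, ENNReal.ofReal (2 * 4 ^ σ) *
        (weight (2 * (σ - α)) j + weight (2 * (σ - α)) (k - j)) := by
        refine ENNReal.tsum_le_tsum fun j => ?_
        simp only [weight]
        rw [← ENNReal.ofReal_mul (by positivity), ← ENNReal.ofReal_mul (by positivity),
          ← ENNReal.ofReal_add (by positivity) (by positivity), ← ENNReal.ofReal_mul (by positivity)]
        exact ENNReal.ofReal_le_ofReal (rpow_weight_convolution_le hσ k j)
    _ = _ := by rw [ENNReal.tsum_mul_left, ENNReal.tsum_add, hshift]

/-- Cauchy–Schwarz in `j` after inserting the weights `(1 + j²)^{±α/2}` and `(1 + (k-j)²)^{±α/2}`: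
one factor is bounded uniformly in `k`, the other is a convolution whose sum over `k` is a product
by Tonelli. -/
lemma weightedSum_convolution_le {σ α : ℝ} (hσ : 0 ≤ σ) (h : 2 * (σ - α) < -(1 / 2)) :
    ∃ C, C < ∞ ∧ ∀ a b : ℤ → ℂ, (∀ k, ‖b k‖ₑ ≤ ∑' j, ‖a j‖ₑ * ‖a (k - j)‖ₑ) →
      weightedSum σ b ≤ C * weightedSum α a ^ 2 := by
  obtain ⟨C, hC, hle⟩ := exists_weight_convolution_le hσ h
  refine ⟨C, hC, fun a b hab => ?_⟩
  set A : ℤ → ℝ≥0∞ := fun j => weight α j * ‖a j‖ₑ ^ 2 with hA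
  have hk : ∀ k, weight σ k * ‖b k‖ₑ ^ 2 ≤ C * ∑' j, A j * A (k - j) := by
    intro k
    have e : ∀ j, ‖a j‖ₑ * ‖a (k - j)‖ₑ = (weight (-(α / 2)) j * weight (-(α / 2)) (k - j)) *
        ((weight (α / 2) j * ‖a j‖ₑ) * (weight (α / 2) (k - j) * ‖a (k - j)‖ₑ)) := by
      intro j
      have h1 := weight_mul_weight (-(α / 2)) (α / 2) j
      have h2 := weight_mul_weight (-(α / 2)) (α / 2) (k - j)
      rw [neg_add_cancel, weight_zero] at h1 h2
      calc _ = 1 * 1 * (‖a j‖ₑ * ‖a (k - j)‖ₑ) := by ring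
        _ = (weight (-(α / 2)) j * weight (α / 2) j) *
            (weight (-(α / 2)) (k - j) * weight (α / 2) (k - j)) * (‖a j‖ₑ * ‖a (k - j)‖ₑ) := by
          rw [h1, h2]
        _ = _ := by ring
    have hcs := ennreal_cauchySchwarz (fun j => weight (-(α / 2)) j * weight (-(α / 2)) (k - j))
      fun j => (weight (α / 2) j * ‖a j‖ₑ) * (weight (α / 2) (k - j) * ‖a (k - j)‖ₑ)
    simp only [mul_pow, weight_sq, mul_neg, mul_div_cancel₀ α (two_ne_zero' ℝ)] at hcs
    calc weight σ k * ‖b k‖ₑ ^ 2 ≤ weight σ k * (∑' j, ‖a j‖ₑ * ‖a (k - j)‖ₑ) ^ 2 := by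
          gcongr
          exact hab k
      _ ≤ weight σ k * ((∑' j, weight (-α) j * weight (-α) (k - j)) * ∑' j, A j * A (k - j)) := by
          simp_rw [e]
          gcongr
      _ ≤ _ := by
          rw [← mul_assoc]
          gcongr
          exact hle k
  calc weightedSum σ b ≤ ∑' k, C * ∑' j, A j * A (k - j) := ENNReal.tsum_le_tsum hk
    _ = C * ∑' j, ∑' k, A j * A (k - j) := by rw [ENNReal.tsum_mul_left, ENNReal.tsum_comm]
    _ = C * ∑' j, A j * weightedSum α a := by
        congr 1
        refine tsum_congr fun j => ?_
        rw [ENNReal.tsum_mul_left]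
        congr 1
        exact (Equiv.subRight j).tsum_eq A
    _ = _ := by
        rw [ENNReal.tsum_mul_right, sq]
        rfl

lemma fourierCoeff_fourier_mul (f : Torus → ℂ) (k j : ℤ) :
    fourierCoeff (fun x => fourier k x * f x) j = fourierCoeff f (j - k) := by
  unfold fourierCoeff
  refine integral_congr_ae (Eventually.of_forall fun x => ?_)
  simp only [smul_eq_mul]
  rw [← mul_assoc, ← fourier_add]
  congr 3
  ring

/-- Parseval's identity for the pair `e^{ikx} f` and `f`. -/
lemma hasSum_coeff_mul_coeff {f : Torus → ℝ} (hf : MemLp f 2 volume) (k : ℤ) :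
    HasSum (fun j => coeff f (k - j) * coeff f j) (coeff (fun x => f x ^ 2) k) := by
  have hy := memLp_ofReal_haar hf
  have hx : MemLp (fun x : Torus => fourier k x * (f x : ℂ)) 2 AddCircle.haarAddCircle := by
    refine hy.of_le (((fourier k).continuous.aestronglyMeasurable).mul hy.1)
      (Eventually.of_forall fun x => ?_)
    rw [norm_mul, norm_fourier_apply, one_mul]
  have h := (fourierBasis (T := 2 * π)).hasSum_inner_mul_inner (hx.toLp _) (hy.toLp _)
  have e1 : ∀ j, inner ℂ (fourierBasis (T := 2 * π) j) (hy.toLp _) = coeff f j := fun j => by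
    rw [← HilbertBasis.repr_apply_apply, fourierBasis_repr]
    exact congrFun (fourierCoeff_congr_ae hy.coeFn_toLp) j
  have e2 : ∀ j, inner ℂ (hx.toLp _) (fourierBasis (T := 2 * π) j) = coeff f (k - j) := fun j => by
    rw [← inner_conj_symm, ← HilbertBasis.repr_apply_apply, fourierBasis_repr,
      congrFun (fourierCoeff_congr_ae hx.coeFn_toLp) j, fourierCoeff_fourier_mul,
      ← neg_sub j k, coeff_neg_eq_conj]
    rfl
  have e3 : inner ℂ (hx.toLp _) (hy.toLp _) = coeff (fun x => f x ^ 2) k := by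
    rw [L2.inner_def, coeff, fourierCoeff]
    refine integral_congr_ae ?_
    filter_upwards [hx.coeFn_toLp, hy.coeFn_toLp] with x h1 h2
    rw [h1, h2]
    simp only [RCLike.inner_apply', map_mul, Complex.conj_ofReal, fourier_neg, smul_eq_mul]
    push_cast
    ring
  rw [e3] at h
  simpa only [e1, e2] using h

lemma enorm_coeff_sq_le {f : Torus → ℝ} (hf : MemLp f 2 volume) (k : ℤ) :
    ‖coeff (fun x => f x ^ 2) k‖ₑ ≤ ∑' j, ‖coeff f j‖ₑ * ‖coeff f (k - j)‖ₑ := by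
  rw [← (hasSum_coeff_mul_coeff hf k).tsum_eq]
  refine enorm_tsum_le_tsum_enorm.trans_eq (tsum_congr fun j => ?_)
  rw [enorm_mul, mul_comm]

/-- Squaring maps `H^α` to `H^σ` if `0 ≤ σ < α - 1/4`. -/
lemma exists_sobolevNormSq_sq_le {σ α : ℝ} (hσ : 0 ≤ σ) (h : 2 * (σ - α) < -(1 / 2)) :
    ∃ C, C < ∞ ∧ ∀ f : Torus → ℝ, MemLp f 2 volume →
      sobolevNormSq σ (fun x => f x ^ 2) ≤ C * sobolevNormSq α f ^ 2 := by
  obtain ⟨C, hC, hle⟩ := weightedSum_convolution_le hσ h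
  exact ⟨C, hC, fun f hf => hle _ _ (enorm_coeff_sq_le hf)⟩

lemma sobolevNormSq_congr_ae (s : ℝ) {f g : Torus → ℝ} (h : f =ᵐ[volume] g) :
    sobolevNormSq s f = sobolevNormSq s g := by
  rw [sobolevNormSq_eq, sobolevNormSq_eq, coeff_congr_ae h]

lemma sobolevNormSq_add_le (s : ℝ) {f g : Torus → ℝ} (hf : Integrable f volume)
    (hg : Integrable g volume) :
    sobolevNormSq s (fun x => f x + g x) ≤ 2 * (sobolevNormSq s f + sobolevNormSq s g) := by
  simp only [sobolevNormSq_eq]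
  rw [show coeff (fun x => f x + g x) = fun k => coeff f k + coeff g k from
    funext (coeff_add hf hg)]
  exact weightedSum_add_le s _ _

/-- `sobolevNormSq` is not the norm of a type, so the bound is proved near each time by the
quasi-triangle inequality and spread by compactness. -/
lemma IsContinuousSobolevPath.exists_bound {T s : ℝ} {v : ℝ → LpT 2}
    (hv : IsContinuousSobolevPath T s v) :
    ∃ R, R < ∞ ∧ ∀ t ∈ Icc 0 T, sobolevNormSq s (v t) ≤ R := by
  refine isCompact_Icc.induction_on (p := fun A => ∃ R, R < ∞ ∧ ∀ t ∈ A, sobolevNormSq s (v t) ≤ R)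
    ⟨0, by simp, by simp⟩ ?_ ?_ ?_
  · rintro A B hAB ⟨R, hR, h⟩
    exact ⟨R, hR, fun t ht => h t (hAB ht)⟩
  · rintro A B ⟨R₁, hR₁, h₁⟩ ⟨R₂, hR₂, h₂⟩
    refine ⟨max R₁ R₂, max_lt hR₁ hR₂, fun t ht => ?_⟩
    rcases ht with ht | ht
    · exact (h₁ t ht).trans (le_max_left _ _)
    · exact (h₂ t ht).trans (le_max_right _ _)
  · intro t ht
    obtain ⟨hfin, hlim⟩ := hv t ht
    refine ⟨_, hlim.eventually (ge_mem_nhds one_pos), 2 * (1 + sobolevNormSq s (v t)),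
      ENNReal.mul_lt_top (by simp) (ENNReal.add_lt_top.2 ⟨by simp, hfin⟩), fun r hr => ?_⟩
    have h1 : sobolevNormSq s (v r) =
        sobolevNormSq s fun x => (v r - v t : LpT 2) x + v t x := by
      refine sobolevNormSq_congr_ae s ?_
      filter_upwards [Lp.coeFn_sub (v r) (v t)] with x hx
      rw [hx, Pi.sub_apply, sub_add_cancel]
    rw [h1]
    refine (sobolevNormSq_add_le s (integrable_coeFn _) (integrable_coeFn _)).trans ?_
    gcongr
    exact hr

/-! ### Regularity of mild solutions -/

lemma mul_integral_exp_le {κ : ℝ} (t : ℝ) :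
    κ * ∫ s in (0 : ℝ)..t, Real.exp (-(t - s) * κ) ≤ 1 := by
  have h : ∀ s ∈ uIcc 0 t, HasDerivAt (fun s => Real.exp (-(t - s) * κ))
      (κ * Real.exp (-(t - s) * κ)) s := by
    intro s _
    have h1 : HasDerivAt (fun s => -(t - s) * κ) κ s := by
      have h2 := (((hasDerivAt_id s).const_sub t).neg).mul_const κ
      simpa using h2
    simpa [mul_comm] using h1.exp
  rw [← intervalIntegral.integral_const_mul,
    intervalIntegral.integral_eq_sub_of_hasDerivAt h (Continuous.intervalIntegrable (by fun_prop) _ _)]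
  simp only [sub_self, neg_zero, zero_mul, Real.exp_zero]
  linarith [Real.exp_pos (-(t - 0) * κ)]

/-- The Cauchy-Schwarz inequality for an exponential kernel. -/
lemma mul_sq_integral_exp_le {κ t : ℝ} (hκ : 0 ≤ κ) (ht : 0 ≤ t) {g : ℝ → ℝ}
    (hg : ContinuousOn g (Icc 0 t)) :
    κ * (∫ s in (0 : ℝ)..t, Real.exp (-(t - s) * κ) * g s) ^ 2 ≤
      ∫ s in (0 : ℝ)..t, Real.exp (-(t - s) * κ) * g s ^ 2 := by
  set J := ∫ s in (0 : ℝ)..t, Real.exp (-(t - s) * κ) * g s with hJ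
  set K := ∫ s in (0 : ℝ)..t, Real.exp (-(t - s) * κ) with hK
  set L := ∫ s in (0 : ℝ)..t, Real.exp (-(t - s) * κ) * g s ^ 2 with hL
  have hi : ∀ f : ℝ → ℝ, ContinuousOn f (Icc 0 t) → IntervalIntegrable f volume 0 t := fun f hf =>
    ContinuousOn.intervalIntegrable (by rwa [uIcc_of_le ht])
  have hK1 : κ * K ≤ 1 := mul_integral_exp_le t
  -- Expanding `∫ e^{-(t-s)κ} (g - c)² ≥ 0` gives `L ≥ 2κJ² - κJ² (κK)`, and `κK ≤ 1` concludes.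
  set c := κ * J with hc
  have h0 : 0 ≤ ∫ s in (0 : ℝ)..t, Real.exp (-(t - s) * κ) * (g s - c) ^ 2 :=
    intervalIntegral.integral_nonneg ht fun s _ => by positivity
  have h1 : ∫ s in (0 : ℝ)..t, Real.exp (-(t - s) * κ) * (g s - c) ^ 2 =
      L - 2 * c * J + c ^ 2 * K := by
    rw [hL, hJ, hK, ← intervalIntegral.integral_const_mul, ← intervalIntegral.integral_const_mul,
      ← intervalIntegral.integral_sub (hi _ (by fun_prop)) (hi _ (by fun_prop)),
      ← intervalIntegral.integral_add (hi _ (by fun_prop)) (hi _ (by fun_prop))]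
    refine intervalIntegral.integral_congr fun s _ => ?_
    ring
  rw [h1, hc] at h0
  have h2 : κ * J ^ 2 * (κ * K) ≤ κ * J ^ 2 * 1 := by gcongr
  nlinarith

/-! ### Fourier modes of a mild solution and the gain of regularity -/

section Modes

variable {p : ℝ≥0∞} [Fact (1 ≤ p)] {T : ℝ} {v : ℝ → LpT 2} {w₀ : LpT p} {w : ℝ → LpT p}

lemma coeffCLM_toLp_heatSmooth {t : ℝ} {a : ℤ → ℂ} (ht : 0 < t) (h : IsFirstOrder a)
    (ha : ∀ k, a (-k) = (starRingEnd ℂ) (a k)) (k : ℤ) :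
    coeffCLM p k (ContinuousMap.toLp p volume ℝ (heatSmooth t a)) =
      (Real.exp (-t * (k : ℝ) ^ 2) : ℂ) * a k := by
  rw [coeffCLM_apply, coeff_congr_ae (ContinuousMap.coeFn_toLp volume _),
    coeff_heatSmooth (h.summable ht) ha]

lemma continuousOn_coeff {q : ℝ≥0∞} [Fact (1 ≤ q)] {F : ℝ → LpT q} {s : Set ℝ}
    (hF : ContinuousOn F s) (k : ℤ) : ContinuousOn (fun t => coeff (F t) k) s := by
  simp only [← coeffCLM_apply]
  exact (coeffCLM q k).continuous.comp_continuousOn hF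

lemma norm_coeff_mild_le (hp : 2 ≤ p) (hp' : p ≠ ∞) (hv : ContinuousOn v (Icc 0 T))
    (hw : IsMildSolution p T v w₀ w) {t : ℝ} (ht : t ∈ Ioc 0 T) (k : ℤ) :
    ‖coeff (w t) k‖ ≤ Real.exp (-t * (k : ℝ) ^ 2) * ‖coeff w₀ k‖ +
      |(k : ℝ)| * ∫ s in (0 : ℝ)..t,
        Real.exp (-(t - s) * (k : ℝ) ^ 2) * ‖coeff (nonlinearity hp (v s) (w s)) k‖ := by
  have ht' : t ∈ Icc 0 T := ⟨ht.1.le, ht.2⟩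
  obtain ⟨hwc, hwt⟩ := (isMildSolution_iff hp hp' hv).1 hw
  obtain ⟨θ, hθ, C, -, h⟩ := exists_norm_heatDerivCLM_le T hp hp'
  have hF := continuousOn_nonlinearity hp hv hwc
  have hi := intervalIntegrable_convolution (continuousOn_heatDerivCLM p) hθ h hF ht'
  have h1 : coeffCLM p k (heat p t w₀) = (Real.exp (-t * (k : ℝ) ^ 2) : ℂ) * coeff w₀ k := by
    rw [heat, if_neg (not_le.2 ht.1)]
    refine coeffCLM_toLp_heatSmooth ht.1 ?_ (coeff_neg_eq_conj _) k
    simpa only [one_mul] using isFirstOrder_mul_coeff isFirstOrder_one w₀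
  have h2 : ∀ s ∈ Ioo 0 t, ‖coeffCLM p k (heatDerivCLM p (t - s) (nonlinearity hp (v s) (w s)))‖ =
      |(k : ℝ)| * (Real.exp (-(t - s) * (k : ℝ) ^ 2) * ‖coeff (nonlinearity hp (v s) (w s)) k‖) := by
    intro s hs
    have hs' : 0 < t - s := sub_pos.2 hs.2
    rw [heatDerivCLM_apply p hs', coeffCLM_toLp_heatSmooth hs' (isFirstOrder_derivCoeff _)
      (derivCoeff_neg_eq_conj _), derivCoeff, norm_mul, norm_mul, norm_mul, Complex.norm_real,
      Real.norm_eq_abs, abs_of_pos (Real.exp_pos _), Complex.norm_I, Complex.norm_intCast]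
    ring
  have hk := congrArg (coeffCLM p k) (hwt t ht')
  rw [map_add, h1, ← (coeffCLM p k).intervalIntegral_comp_comm hi, coeffCLM_apply] at hk
  rw [hk]
  refine (norm_add_le _ _).trans (add_le_add (le_of_eq ?_) ?_)
  · rw [norm_mul, Complex.norm_real, Real.norm_eq_abs, abs_of_pos (Real.exp_pos _)]
  · rw [← intervalIntegral.integral_const_mul]
    refine intervalIntegral.norm_integral_le_of_norm_le ht.1.le ?_ ?_
    · have hne : ∀ᵐ s : ℝ, s ≠ t := by simp [ae_iff, measure_singleton]
      filter_upwards [hne] with s hst hs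
      exact (h2 s ⟨hs.1, lt_of_le_of_ne hs.2 hst⟩).le
    · refine ContinuousOn.intervalIntegrable ?_
      rw [uIcc_of_le ht.1.le]
      have := (continuousOn_coeff hF k).mono (Icc_subset_Icc_right ht.2)
      fun_prop

/-- `mul_sq_integral_exp_le` with `κ = k²` absorbs the whole factor `k²` of the derivative, so no
power of `k` remains in front of the integral. -/
lemma norm_sq_coeff_mild_le (hp : 2 ≤ p) (hp' : p ≠ ∞) (hv : ContinuousOn v (Icc 0 T))
    (hw : IsMildSolution p T v w₀ w) {t : ℝ} (ht : t ∈ Ioc 0 T) (k : ℤ) :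
    ‖coeff (w t) k‖ ^ 2 ≤ 2 * (Real.exp (-t * (k : ℝ) ^ 2) * ‖coeff w₀ k‖ ^ 2) +
      2 * ∫ s in (0 : ℝ)..t,
        Real.exp (-(t - s) * (k : ℝ) ^ 2) * ‖coeff (nonlinearity hp (v s) (w s)) k‖ ^ 2 := by
  have h1 := norm_coeff_mild_le hp hp' hv hw ht k
  have hF := (continuousOn_coeff (continuousOn_nonlinearity hp hv hw.1) k).mono
    (Icc_subset_Icc_right ht.2)
  have h2 := mul_sq_integral_exp_le (sq_nonneg (k : ℝ)) ht.1.le hF.norm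
  set x := Real.exp (-t * (k : ℝ) ^ 2)
  set J := ∫ s in (0 : ℝ)..t,
    Real.exp (-(t - s) * (k : ℝ) ^ 2) * ‖coeff (nonlinearity hp (v s) (w s)) k‖
  have hx0 : 0 < x := Real.exp_pos _
  have hx1 : x ≤ 1 := Real.exp_le_one_iff.2 (by nlinarith [mul_nonneg ht.1.le (sq_nonneg (k : ℝ))])
  have h3 : (x * ‖coeff w₀ k‖) ^ 2 ≤ x * ‖coeff w₀ k‖ ^ 2 := by
    rw [mul_pow]
    have : x ^ 2 ≤ x := by nlinarith
    gcongr
  have h4 : (|(k : ℝ)| * J) ^ 2 = (k : ℝ) ^ 2 * J ^ 2 := by rw [mul_pow, sq_abs]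
  have h5 : ‖coeff (w t) k‖ ^ 2 ≤ (x * ‖coeff w₀ k‖ + |(k : ℝ)| * J) ^ 2 := by gcongr
  nlinarith [sq_nonneg (x * ‖coeff w₀ k‖ - |(k : ℝ)| * J)]

/-- For positive times the Fourier coefficients of a mild solution decay like `1 / |k|`. -/
lemma exists_norm_sq_coeff_mild_le (hp : 2 ≤ p) (hp' : p ≠ ∞) (hv : ContinuousOn v (Icc 0 T))
    (hw : IsMildSolution p T v w₀ w) {t₀ : ℝ} (ht₀ : 0 < t₀) :
    ∃ B, 0 ≤ B ∧ ∀ t ∈ Icc t₀ T, ∀ k : ℤ,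
      ‖coeff (w t) k‖ ^ 2 ≤ B * (1 + (k : ℝ) ^ 2) ^ (-1 : ℝ) := by
  obtain ⟨D, hD, hDw⟩ := exists_norm_coeff_le p
  obtain ⟨D₁, hD₁, hDF⟩ := exists_norm_coeff_le 1
  have hF := continuousOn_nonlinearity hp hv hw.1
  obtain ⟨M, hM⟩ := isCompact_Icc.exists_bound_of_continuousOn hF
  obtain ⟨C, hC, hexp⟩ := exists_heat_symbol_le T 1 zero_le_one
  refine ⟨2 * (C * t₀⁻¹ * (D * ‖w₀‖) ^ 2) + 2 * ((D₁ * M) ^ 2 * Real.exp T), by positivity,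
    fun t ht k => ?_⟩
  have ht0 : 0 < t := ht₀.trans_le ht.1
  have htT : t ∈ Ioc 0 T := ⟨ht0, ht.2⟩
  have hκ := one_add_sq_pos k
  refine (norm_sq_coeff_mild_le hp hp' hv hw htT k).trans ?_
  have h1 : Real.exp (-t * (k : ℝ) ^ 2) * ‖coeff w₀ k‖ ^ 2 ≤
      C * t₀⁻¹ * (D * ‖w₀‖) ^ 2 * (1 + (k : ℝ) ^ 2) ^ (-1 : ℝ) := by
    have e1 : t ^ (-1 : ℝ) ≤ t₀⁻¹ := by
      rw [Real.rpow_neg_one]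
      exact inv_anti₀ ht₀ ht.1
    calc _ ≤ (C * t ^ (-1 : ℝ) * (1 + (k : ℝ) ^ 2) ^ (-1 : ℝ)) * (D * ‖w₀‖) ^ 2 := by
          gcongr
          · exact hexp t htT k
          · exact hDw w₀ k
      _ ≤ (C * t₀⁻¹ * (1 + (k : ℝ) ^ 2) ^ (-1 : ℝ)) * (D * ‖w₀‖) ^ 2 := by gcongr
      _ = _ := by ring
  have h2 : ∫ s in (0 : ℝ)..t,
      Real.exp (-(t - s) * (k : ℝ) ^ 2) * ‖coeff (nonlinearity hp (v s) (w s)) k‖ ^ 2 ≤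
      (D₁ * M) ^ 2 * Real.exp T * (1 + (k : ℝ) ^ 2) ^ (-1 : ℝ) := by
    have hFk := (continuousOn_coeff hF k).mono (Icc_subset_Icc_right ht.2)
    -- The factor `e^T` turns the rate `k²` into `1 + k²`, so that the time integral is at most `1 /
    -- (1 + k²)` even for `k = 0`.
    calc _ ≤ ∫ s in (0 : ℝ)..t, (D₁ * M) ^ 2 * Real.exp T *
          Real.exp (-(t - s) * (1 + (k : ℝ) ^ 2)) := by
          refine intervalIntegral.integral_mono_on ht0.le ?_
            (Continuous.intervalIntegrable (by fun_prop) _ _) fun s hs => ?_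
          · refine ContinuousOn.intervalIntegrable ?_
            rw [uIcc_of_le ht0.le]
            fun_prop
          · have hs' : s ∈ Icc 0 T := ⟨hs.1, hs.2.trans ht.2⟩
            have e2 : ‖coeff (nonlinearity hp (v s) (w s)) k‖ ≤ D₁ * M :=
              (hDF _ k).trans (by gcongr; exact hM s hs')
            have e3 : Real.exp (-(t - s) * (k : ℝ) ^ 2) ≤
                Real.exp T * Real.exp (-(t - s) * (1 + (k : ℝ) ^ 2)) := by
              rw [← Real.exp_add, Real.exp_le_exp]
              nlinarith [hs.1, ht.2]
            calc _ ≤ (Real.exp T * Real.exp (-(t - s) * (1 + (k : ℝ) ^ 2))) * (D₁ * M) ^ 2 := by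
                  gcongr
              _ = _ := by ring
      _ ≤ _ := by
          rw [intervalIntegral.integral_const_mul]
          refine mul_le_mul_of_nonneg_left ?_ (by positivity)
          rw [Real.rpow_neg_one, ← one_div, le_div_iff₀ hκ, mul_comm]
          exact mul_integral_exp_le t
  linarith

/-- The `1/(1+k²)` decay of the squared coefficients makes the `H^s` series converge exactly when
`2(s - 1) < -1`. -/
lemma exists_sobolevNormSq_mild_le (hp : 2 ≤ p) (hp' : p ≠ ∞) (hv : ContinuousOn v (Icc 0 T))
    (hw : IsMildSolution p T v w₀ w) {t₀ : ℝ} (ht₀ : 0 < t₀) {s : ℝ} (hs : s < 1 / 2) :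
    ∃ R, R < ∞ ∧ ∀ t ∈ Icc t₀ T, sobolevNormSq s (w t) ≤ R := by
  obtain ⟨B, hB, h⟩ := exists_norm_sq_coeff_mild_le hp hp' hv hw ht₀
  have hsum := (summable_one_add_sq_rpow (s := s + -1) (by linarith)).mul_left B
  refine ⟨ENNReal.ofReal (∑' k : ℤ, B * (1 + (k : ℝ) ^ 2) ^ (s + -1)), ENNReal.ofReal_lt_top,
    fun t ht => ?_⟩
  rw [ENNReal.ofReal_tsum_of_nonneg (fun k => by positivity) hsum]
  refine ENNReal.tsum_le_tsum fun k => ?_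
  rw [enorm_sq_eq_ofReal, ← ENNReal.ofReal_mul (by positivity)]
  refine ENNReal.ofReal_le_ofReal ?_
  calc _ ≤ (1 + (k : ℝ) ^ 2) ^ s * (B * (1 + (k : ℝ) ^ 2) ^ (-1 : ℝ)) := by
        gcongr
        exact h t ht k
    _ = _ := by
        rw [Real.rpow_add (one_add_sq_pos k)]
        ring

lemma sum_le_of_weightedSum_le {s : ℝ} {a : ℤ → ℂ} {R : ℝ≥0∞} (hR : R < ∞)
    (h : weightedSum s a ≤ R) (u : Finset ℤ) :
    ∑ k ∈ u, (1 + (k : ℝ) ^ 2) ^ s * ‖a k‖ ^ 2 ≤ R.toReal := by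
  rw [← ENNReal.ofReal_le_iff_le_toReal hR.ne, ENNReal.ofReal_sum_of_nonneg fun k _ => by positivity]
  refine le_trans (le_of_eq ?_) ((ENNReal.sum_le_tsum u).trans h)
  refine Finset.sum_congr rfl fun k _ => ?_
  rw [ENNReal.ofReal_mul (by positivity), weight, enorm_sq_eq_ofReal]

/-- The nonlinearity of a mild solution is bounded in `H^σ` away from the initial time. -/
lemma exists_sobolevNormSq_nonlinearity_le (hp : 2 ≤ p) (hp' : p ≠ ∞) {α : ℝ} (hα : 0 ≤ α)
    (hα' : α < 1 / 2) (hv : IsContinuousSobolevPath T α v)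
    (hw : IsMildSolution p T v w₀ w) {t₀ : ℝ} (ht₀ : 0 < t₀) {σ : ℝ} (hσ : 0 ≤ σ)
    (hσα : 2 * (σ - α) < -(1 / 2)) :
    ∃ R, R < ∞ ∧ ∀ t ∈ Icc t₀ T, sobolevNormSq σ (nonlinearity hp (v t) (w t)) ≤ R := by
  obtain ⟨R₁, hR₁, h₁⟩ := hv.exists_bound
  obtain ⟨R₂, hR₂, h₂⟩ := exists_sobolevNormSq_mild_le hp hp' (hv.continuousOn hα) hw ht₀ hα'
  obtain ⟨C, hC, h⟩ := exists_sobolevNormSq_sq_le hσ hσα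
  refine ⟨C * (2 * (R₂ + R₁)) ^ 2, ENNReal.mul_lt_top hC (ENNReal.pow_lt_top
    (ENNReal.mul_lt_top (by simp) (ENNReal.add_lt_top.2 ⟨hR₂, hR₁⟩))), fun t ht => ?_⟩
  have hu : MemLp (fun x => w t x + v t x) 2 volume :=
    ((Lp.memLp (w t)).mono_exponent hp).add (Lp.memLp (v t))
  rw [sobolevNormSq_eq, coeff_nonlinearity]
  refine (h _ hu).trans ?_
  gcongr
  refine (sobolevNormSq_add_le α (integrable_coeFn _) (integrable_coeFn _)).trans ?_
  gcongr
  · exact h₂ t ht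
  · exact h₁ t ⟨ht₀.le.trans ht.1, ht.2⟩

/-- The contribution to `w t` of a nonlinearity bounded in `H^σ` lies in `H^{1 + σ - δ}`. -/
lemma summable_integral_exp_mul {a : ℝ → ℤ → ℂ} {r t : ℝ} (hrt : r ≤ t)
    (ha : ∀ k, ContinuousOn (fun s => a s k) (Icc r t)) {σ δ : ℝ} (hδ : 0 < δ) (hδ' : δ ≤ 1)
    {R : ℝ≥0∞} (hR : R < ∞) (hle : ∀ s ∈ Icc r t, weightedSum σ (a s) ≤ R) :
    Summable fun k : ℤ => (1 + (k : ℝ) ^ 2) ^ (1 + σ - δ) *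
      ∫ s in r..t, Real.exp (-(t - s) * (k : ℝ) ^ 2) * ‖a s k‖ ^ 2 := by
  -- Spending only the power `1 - δ` of the heat decay leaves `(t - s)^{δ-1}`, which is integrable
  -- at `s = t`.
  obtain ⟨C, hC, hexp⟩ := exists_heat_symbol_le (t - r) (1 - δ) (by linarith)
  have hcont : ∀ k : ℤ,
      ContinuousOn (fun s => Real.exp (-(t - s) * (k : ℝ) ^ 2) * ‖a s k‖ ^ 2) (Icc r t) := fun k => by
    have := ha k
    fun_prop
  -- Bounding finite partial sums uniformly lets the sum pass inside the time integral, where the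
  -- `H^σ` bound applies at each `s`.
  refine summable_of_sum_le (c := ∫ s in r..t, C * R.toReal * (t - s) ^ (δ - 1)) (fun k => ?_)
    fun u => ?_
  · have : 0 ≤ ∫ s in r..t, Real.exp (-(t - s) * (k : ℝ) ^ 2) * ‖a s k‖ ^ 2 :=
      intervalIntegral.integral_nonneg hrt fun s _ => by positivity
    simp only [Pi.zero_apply]
    positivity
  · simp only [← intervalIntegral.integral_const_mul]
    rw [← intervalIntegral.integral_finsetSum fun k _ => by
      refine ContinuousOn.intervalIntegrable ?_
      rw [uIcc_of_le hrt]
      exact (hcont k).const_mul _]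
    refine intervalIntegral.integral_mono_on_of_le_Ioo hrt ?_
      ((intervalIntegrable_sub_rpow hδ r t t).const_mul _) fun s hs => ?_
    · refine ContinuousOn.intervalIntegrable ?_
      rw [uIcc_of_le hrt]
      exact continuousOn_finsetSum _ fun k _ => (hcont k).const_mul _
    · have hts : 0 < t - s := sub_pos.2 hs.2
      calc _ ≤ ∑ k ∈ u, C * (t - s) ^ (δ - 1) * ((1 + (k : ℝ) ^ 2) ^ σ * ‖a s k‖ ^ 2) := by
            refine Finset.sum_le_sum fun k _ => ?_
            have h1 := hexp (t - s) ⟨hts, by linarith [hs.1]⟩ k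
            calc _ ≤ (1 + (k : ℝ) ^ 2) ^ (1 + σ - δ) *
                  (C * (t - s) ^ (-(1 - δ)) * (1 + (k : ℝ) ^ 2) ^ (-(1 - δ)) * ‖a s k‖ ^ 2) := by
                  gcongr
              _ = C * (t - s) ^ (-(1 - δ)) * (((1 + (k : ℝ) ^ 2) ^ (1 + σ - δ) *
                  (1 + (k : ℝ) ^ 2) ^ (-(1 - δ))) * ‖a s k‖ ^ 2) := by ring
              _ = _ := by
                  rw [← Real.rpow_add (one_add_sq_pos k)]
                  ring_nf
        _ = C * (t - s) ^ (δ - 1) * ∑ k ∈ u, (1 + (k : ℝ) ^ 2) ^ σ * ‖a s k‖ ^ 2 := by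
            rw [Finset.mul_sum]
        _ ≤ C * (t - s) ^ (δ - 1) * R.toReal := by
            gcongr
            exact sum_le_of_weightedSum_le hR (hle s ⟨hs.1.le, hs.2.le⟩) u
        _ = _ := by ring

/-- Duhamel's integral is split at `t / 2`. Before it, `e^{-(t/2)k²}` beats every power of `k` and
the `L¹` bound on the nonlinearity is enough; after it, the nonlinearity is bounded in `H^σ` and
`summable_integral_exp_mul` applies. -/
theorem sobolevNormSq_mild_lt_top (hp : 2 ≤ p) (hp' : p ≠ ∞) {α : ℝ} (hα : 0 ≤ α)
    (hα' : α < 1 / 2) (hv : IsContinuousSobolevPath T α v) (hw : IsMildSolution p T v w₀ w)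
    {σ δ : ℝ} (hσ : 0 ≤ σ) (hσα : 2 * (σ - α) < -(1 / 2)) (hδ : 0 < δ) (hδ' : δ ≤ 1)
    {t : ℝ} (ht : t ∈ Ioc 0 T) : sobolevNormSq (1 + σ - δ) (w t) < ∞ := by
  have ht0 := ht.1
  have hvc := hv.continuousOn hα
  have hF := continuousOn_nonlinearity hp hvc hw.1
  obtain ⟨D, hD, hDw⟩ := exists_norm_coeff_le p
  obtain ⟨D₁, hD₁, hDF⟩ := exists_norm_coeff_le 1
  obtain ⟨M, hM⟩ := isCompact_Icc.exists_bound_of_continuousOn hF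
  obtain ⟨R, hR, hRle⟩ := exists_sobolevNormSq_nonlinearity_le hp hp' hα hα' hv hw
    (half_pos ht0) hσ hσα
  set a : ℝ → ℤ → ℂ := fun s => coeff (nonlinearity hp (v s) (w s)) with ha
  have hak : ∀ k, ContinuousOn (fun s => a s k) (Icc 0 T) := fun k => continuousOn_coeff hF k
  have hhalf : t / 2 ≤ t := by linarith
  have hsum := summable_integral_exp_mul (a := a) hhalf
    (fun k => (hak k).mono (Icc_subset_Icc (by linarith) ht.2)) hδ hδ' hR
    fun s hs => hRle s ⟨hs.1, hs.2.trans ht.2⟩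
  set β := 1 + σ - δ
  refine weightedSum_lt_top_of_summable (Summable.of_nonneg_of_le (fun k => by positivity)
    (fun k => ?_) ((((summable_heat_symbol ht0 β).mul_left (2 * (D * ‖w₀‖) ^ 2)).add
      ((summable_heat_symbol (half_pos ht0) β).mul_left (2 * ((D₁ * M) ^ 2 * (t / 2))))).add
      (hsum.mul_left 2)))
  have hcont : ∀ x y, 0 ≤ x → x ≤ y → y ≤ T → IntervalIntegrable
      (fun s => Real.exp (-(t - s) * (k : ℝ) ^ 2) * ‖a s k‖ ^ 2) volume x y := by
    intro x y hx hxy hy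
    refine ContinuousOn.intervalIntegrable ?_
    rw [uIcc_of_le hxy]
    have := (hak k).mono (Icc_subset_Icc hx hy)
    fun_prop
  have h1 := norm_sq_coeff_mild_le hp hp' hvc hw ht k
  have h2 : ∫ s in (0 : ℝ)..t, Real.exp (-(t - s) * (k : ℝ) ^ 2) * ‖a s k‖ ^ 2 =
      (∫ s in (0 : ℝ)..(t / 2), Real.exp (-(t - s) * (k : ℝ) ^ 2) * ‖a s k‖ ^ 2) +
        ∫ s in (t / 2)..t, Real.exp (-(t - s) * (k : ℝ) ^ 2) * ‖a s k‖ ^ 2 :=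
    (intervalIntegral.integral_add_adjacent_intervals
      (hcont 0 (t / 2) le_rfl (by linarith) (by linarith [ht.2]))
      (hcont (t / 2) t (by linarith) hhalf ht.2)).symm
  have h3 : ∫ s in (0 : ℝ)..(t / 2), Real.exp (-(t - s) * (k : ℝ) ^ 2) * ‖a s k‖ ^ 2 ≤
      (D₁ * M) ^ 2 * (t / 2) * Real.exp (-(t / 2) * (k : ℝ) ^ 2) := by
    have h4 : ∫ s in (0 : ℝ)..(t / 2), Real.exp (-(t - s) * (k : ℝ) ^ 2) * ‖a s k‖ ^ 2 ≤
        ∫ _ in (0 : ℝ)..(t / 2), Real.exp (-(t / 2) * (k : ℝ) ^ 2) * (D₁ * M) ^ 2 := by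
      refine intervalIntegral.integral_mono_on (by linarith)
        (hcont 0 (t / 2) le_rfl (by linarith) (by linarith [ht.2])) (by simp) fun s hs => ?_
      have hs' : s ∈ Icc 0 T := ⟨hs.1, by linarith [hs.2, ht.2]⟩
      have e1 : ‖a s k‖ ≤ D₁ * M := (hDF _ k).trans (by gcongr; exact hM s hs')
      have e2 : -(t - s) ≤ -(t / 2) := by linarith [hs.2]
      gcongr
    refine h4.trans_eq ?_
    rw [intervalIntegral.integral_const, smul_eq_mul, sub_zero]
    ring
  have h5 : Real.exp (-t * (k : ℝ) ^ 2) * ‖coeff w₀ k‖ ^ 2 ≤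
      Real.exp (-t * (k : ℝ) ^ 2) * (D * ‖w₀‖) ^ 2 := by
    gcongr
    exact hDw w₀ k
  set I₂ := ∫ s in (t / 2)..t, Real.exp (-(t - s) * (k : ℝ) ^ 2) * ‖a s k‖ ^ 2
  have h6 : ‖coeff (w t) k‖ ^ 2 ≤ 2 * (Real.exp (-t * (k : ℝ) ^ 2) * (D * ‖w₀‖) ^ 2) +
      2 * ((D₁ * M) ^ 2 * (t / 2) * Real.exp (-(t / 2) * (k : ℝ) ^ 2)) + 2 * I₂ := by
    refine h1.trans ?_
    rw [h2]
    linarith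
  calc _ ≤ (1 + (k : ℝ) ^ 2) ^ β * (2 * (Real.exp (-t * (k : ℝ) ^ 2) * (D * ‖w₀‖) ^ 2) +
      2 * ((D₁ * M) ^ 2 * (t / 2) * Real.exp (-(t / 2) * (k : ℝ) ^ 2)) + 2 * I₂) := by gcongr
    _ = _ := by ring

end Modes

end BurgersRemainder

end

theorem mainTheorem9 (T : ℝ) (hT : 0 < T) (p : ℝ≥0∞) [Fact (1 ≤ p)] (hp : 2 ≤ p) (hp_top : p ≠ ∞)
    (α : ℝ) (hα : 0 ≤ α) (hα' : α < 1 / 2) (hpα : p.toReal ≤ 2 / (1 - 2 * α))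
    (v : ℝ → BurgersRemainder.LpT 2) (hv : BurgersRemainder.IsContinuousSobolevPath T α v)
    (w₀ : BurgersRemainder.LpT p) :
    ∃ Tstar : ℝ, 0 < Tstar ∧ Tstar ≤ T ∧
      ∃ w : ℝ → BurgersRemainder.LpT p,
        BurgersRemainder.IsMildSolution p Tstar v w₀ w ∧
        (∀ w' : ℝ → BurgersRemainder.LpT p,
          BurgersRemainder.IsMildSolution p Tstar v w₀ w' → EqOn w' w (Icc 0 Tstar)) ∧
        (4 < p → ∃ β : ℝ, 1 < β ∧
          ∀ t : ℝ, 0 < t → t ≤ Tstar → BurgersRemainder.sobolevNormSq β (w t) < ∞) := by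
  have hvc := hv.continuousOn hα
  obtain ⟨T', hT'0, hT'T, w, hw, huniq⟩ :=
    BurgersRemainder.exists_unique_isMildSolution hT hp hp_top hvc w₀
  refine ⟨T', hT'0, hT'T, w, hw, huniq, fun h4 => ?_⟩
  -- From `4 < p ≤ 2 / (1 - 2α)` one gets `4 (1 - 2α) < 2`.
  have hα4 : 1 / 4 < α := by
    have h1 : 4 < p.toReal := by
      have := ENNReal.toReal_strict_mono hp_top h4
      simpa using this
    have h2 := h1.trans_le hpα
    rw [lt_div_iff₀ (by linarith)] at h2
    linarith
  have hv' : BurgersRemainder.IsContinuousSobolevPath T' α v := fun t ht =>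
    ⟨(hv t ⟨ht.1, ht.2.trans hT'T⟩).1, (hv t ⟨ht.1, ht.2.trans hT'T⟩).2.mono_left
      (nhdsWithin_mono _ (Icc_subset_Icc_right hT'T))⟩
  -- Here `σ = (4α - 1)/8` is half of the admissible bound `α - 1/4`, and `δ = σ / 2`, so `β = 1 + σ
  -- / 2`.
  refine ⟨1 + (4 * α - 1) / 8 - (4 * α - 1) / 16, by linarith, fun t ht0 ht => ?_⟩
  exact BurgersRemainder.sobolevNormSq_mild_lt_top hp hp_top hα hα' hv' hw (by linarith)
    (by linarith) (by linarith) (by linarith) ⟨ht0, ht⟩
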